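/- Let $d_1\le d_2\le d_3$ be non-negative integers. In $\mathbb{C}[t_1,t_2,t_3,x_1,x_2,x_3]$, bigraded so that each $t_i$ has bidegree $(1,0)$ (recorded by $q$) and each $x_i$ has bidegree $(0,1)$ (recorded by $t$), let $$J'(d_1,d_2,d_3)=\bigcap_{i\ne j}(t_i-t_j,\;x_i-x_j)^{\min(d_i,d_j)},\qquad \mathfrak{m}=(t_1,t_2,t_3,x_1,x_2,x_3).$$ The Hilbert series of a bigraded complex vector space $V=\bigoplus V_{i,j}$ is $\sum_{i,j\ge 0}\dim_{\mathbb{C}}(V_{i,j})\,q^it^j$. Put $\omega(x)=\frac{(1-x)(1-qtx)}{(1-qx)(1-tx)}$ and define the rational functions $$H(d_1,\ldots,d_n)=\sum_{T}\frac{z_1^{d_n}\cdots z_n^{d_1}}{(1-q)^n(1-t)^n}\prod_{i=2}^{n}\frac{1}{1-z_i^{-1}}\prod_{i<j}\omega(z_i/z_j),$$ $$F(d_1,\ldots,d_n)=\sum_{T}z_1^{d_n}\cdots z_n^{d_1}\prod_{i=2}^{n}\frac{1}{(1-z_i^{-1})(1-qtz_{i-1}/z_i)}\prod_{i<j}\omega(z_i/z_j),$$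 where $T$ runs over the standard tableaux with $n$ boxes, $z_i=q^{c-1}t^{r-1}$ if the label $i$ lies in row $r$ and column $c$ of $T$, and factors of the form $(1-1)$, in numerators or denominators, are ignored. ($F$ is the generalized $(q,t)$-Catalan number.) Then the following hold, where a power series is said to equal a rational function if the two agree in the fraction field of $\mathbb{Q}[[q,t]]$. (a) The Hilbert series of $J'(d_1,d_2,d_3)$ equals $H(d_1,d_2,d_3)$. (b) The Hilbert series of $J'(d_1,d_2,d_3)/\mathfrak{m}J'(d_1,d_2,d_3)$ equals $F(d_1,d_2,d_3)$. (c) In $\mathbb{C}[a,b,c,d]$, where $a,c$ have bidegree $(1,0)$ and $b,d$ have bidegree $(0,1)$, the Hilbert series of the ideal $J(d_1,d_2)=(a,b)^{d_1}\cap(c,d)^{d_2}\cap(a-c,b-d)^{d_1}$ equals $$\frac{q^{2d_1+d_2}}{(1-q)^2(1-t/q)(1-t/q^2)}+\frac{t^{2d_1+d_2}}{(1-t)^2(1-q/t)(1-q/t^2)}+\frac{q^{d_1}t^{d_2}(1+t)}{(1-q)(1-t)(1-q/t)(1-t^2/q)}+\frac{q^{d_2}t^{d_1}(1+q)}{(1-t)(1-q)(1-t/q)(1-q^2/t)}.$$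 -/

import Mathlib

namespace GenHaiman

noncomputable section

/-! ### Rational functions in `q`, `t` and their power series expansions -/

/-- The field `ℚ(q,t)` of rational functions. -/
abbrev RatQT : Type := FractionRing (MvPolynomial (Fin 2) ℚ)

/-- The variable `q` of `ℚ(q,t)`. -/
def q : RatQT := algebraMap (MvPolynomial (Fin 2) ℚ) RatQT (MvPolynomial.X 0)

/-- The variable `t` of `ℚ(q,t)`. -/
def t : RatQT := algebraMap (MvPolynomial (Fin 2) ℚ) RatQT (MvPolynomial.X 1)

/-- The ring `ℚ⟦q,t⟧` of power series; the variables `0` and `1` are `q` and `t`. -/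
abbrev SeriesQT : Type := MvPowerSeries (Fin 2) ℚ

instance : IsDomain SeriesQT := NoZeroDivisors.to_isDomain _

/-- The embedding of fields `ℚ(q,t) → Frac ℚ⟦q,t⟧` that extends `ℚ[q,t] ⊆ ℚ⟦q,t⟧`. -/
def ratToFrac : RatQT →+* FractionRing SeriesQT :=
  IsFractionRing.map
    (j := (MvPolynomial.coeToMvPowerSeries.ringHom : MvPolynomial (Fin 2) ℚ →+* SeriesQT))
    (MvPolynomial.coe_injective (Fin 2) ℚ)

/-- The power series `f` equals the rational function `r`: the two have the same image in the
common overfield `Frac ℚ⟦q,t⟧`. -/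
def SeriesEqRat (f : SeriesQT) (r : RatQT) : Prop :=
  algebraMap SeriesQT (FractionRing SeriesQT) f = ratToFrac r

/-! ### Standard tableaux and the rational functions `H` and `F` -/

/-- Standard tableaux with `n` boxes. `T k` is the box (row, column), both counted from `0`,
that contains the label `k`, and labels are counted from `0` too. A diagram with `n` boxes fits
into the `n × n` square, so boxes are taken in `Fin n × Fin n`. The three conditions say: different
labels lie in different boxes; the occupied boxes form a Young diagram (if a box is occupied, so is
every box weakly above and weakly to the left of it); labels increase along rows and columns. -/
def IsStandardTableau {n : ℕ} (T : Fin n → Fin n × Fin n) : Prop :=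
  (∀ k l, T k = T l → k = l) ∧
  (∀ k b, b ≤ T k → ∃ l, T l = b) ∧
  (∀ k l, T k ≤ T l → k ≤ l)

instance {n : ℕ} : DecidablePred (IsStandardTableau (n := n)) := fun T => by
  unfold IsStandardTableau; infer_instance

/-- The finite set of standard tableaux with `n` boxes. -/
def standardTableaux (n : ℕ) : Finset (Fin n → Fin n × Fin n) :=
  Finset.univ.filter IsStandardTableau

/-- The `(q,t)`-content of the box that contains the label `k`, namely `q ^ column * t ^ row` with
rows and columns counted from `0`. -/
def content {n : ℕ} (T : Fin n → Fin n × Fin n) (k : Fin n) : RatQT :=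
  q ^ ((T k).2 : ℕ) * t ^ ((T k).1 : ℕ)

open scoped Classical in
/-- The factor `1 - x`, where a factor `1 - 1` is ignored (replaced by `1`). -/
def factor (x : RatQT) : RatQT := if x = 1 then 1 else 1 - x

/-- `ω(x) = (1 - x)(1 - q t x) / ((1 - q x)(1 - t x))`, with factors `1 - 1` ignored. -/
def omega (x : RatQT) : RatQT :=
  (factor x * factor (q * t * x)) / (factor (q * x) * factor (t * x))

/-- `H(d₁,…,dₙ)` for `n = m + 1`, the sum over standard tableaux with `n` boxes of
`z₁^{dₙ} ⋯ zₙ^{d₁} / ((1-q)ⁿ(1-t)ⁿ) · ∏_{i ≥ 2} 1/(1 - zᵢ⁻¹) · ∏_{i < j} ω(zᵢ/zⱼ)`. -/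
def H {m : ℕ} (d : Fin (m + 1) → ℕ) : RatQT :=
  ∑ T ∈ standardTableaux (m + 1),
    (∏ i, content T i ^ d i.rev) / ((1 - q) ^ (m + 1) * (1 - t) ^ (m + 1)) *
    (∏ i : Fin m, 1 / factor ((content T i.succ)⁻¹)) *
    ∏ i, ∏ j ∈ Finset.Ioi i, omega (content T i / content T j)

/-- `F(d₁,…,dₙ)` for `n = m + 1`, the generalized `(q,t)`-Catalan number: the sum over standard
tableaux with `n` boxes of
`z₁^{dₙ} ⋯ zₙ^{d₁} · ∏_{i ≥ 2} 1/((1 - zᵢ⁻¹)(1 - q t zᵢ₋₁/zᵢ)) · ∏_{i < j} ω(zᵢ/zⱼ)`. -/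
def F {m : ℕ} (d : Fin (m + 1) → ℕ) : RatQT :=
  ∑ T ∈ standardTableaux (m + 1),
    (∏ i, content T i ^ d i.rev) *
    (∏ i : Fin m, 1 / (factor ((content T i.succ)⁻¹) *
      factor (q * t * content T i.castSucc / content T i.succ))) *
    ∏ i, ∏ j ∈ Finset.Ioi i, omega (content T i / content T j)

/-! ### Bigraded Hilbert series -/

/-- The Hilbert series `∑ dim(V_{i,j}) qⁱ tʲ` of a bigraded complex vector space `V` with the
graded pieces `V_{i,j}`. -/
def hilbertSeries {V : Type*} [AddCommGroup V] [Module ℂ V] (piece : ℕ × ℕ → Submodule ℂ V) :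
    SeriesQT :=
  fun e => (Module.finrank ℂ (piece (e 0, e 1)) : ℚ)

variable {σ : Type*}

/-- The piece of bidegree `e` of an ideal `I` of a polynomial ring, where the variable `s` has
bidegree `w s`. -/
def idealPiece (w : σ → ℕ × ℕ) (I : Ideal (MvPolynomial σ ℂ)) (e : ℕ × ℕ) : Submodule ℂ I :=
  (MvPolynomial.weightedHomogeneousSubmodule ℂ w e).comap (I.subtype.restrictScalars ℂ)

/-- The ideal `𝔪` generated by all the variables. -/
def maxIdeal (σ : Type*) : Ideal (MvPolynomial σ ℂ) :=
  Ideal.span (Set.range MvPolynomial.X)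

/-- The module `I/𝔪I`. -/
abbrev GeneratingSpace (I : Ideal (MvPolynomial σ ℂ)) : Type _ :=
  I ⧸ (maxIdeal σ • ⊤ : Submodule (MvPolynomial σ ℂ) I)

/-- The piece of bidegree `e` of `I/𝔪I`: the image of that of `I`. -/
def generatingPiece (w : σ → ℕ × ℕ) (I : Ideal (MvPolynomial σ ℂ)) (e : ℕ × ℕ) :
    Submodule ℂ (GeneratingSpace I) :=
  (idealPiece w I e).map
    ((maxIdeal σ • ⊤ : Submodule (MvPolynomial σ ℂ) I).mkQ.restrictScalars ℂ)

/-! ### The ideals `J'` and `J` -/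

open MvPolynomial in
/-- `J'(d₁,…,dₙ) = ⋂_{i ≠ j} (tᵢ - tⱼ, xᵢ - xⱼ)^{min(dᵢ,dⱼ)}` in `ℂ[t₁,…,tₙ,x₁,…,xₙ]`, where
`tᵢ = X (inl i)` and `xᵢ = X (inr i)`. -/
def JPrime {n : ℕ} (d : Fin n → ℕ) : Ideal (MvPolynomial (Fin n ⊕ Fin n) ℂ) :=
  ⨅ (i : Fin n) (j : Fin n) (_ : i ≠ j),
    Ideal.span {X (Sum.inl i) - X (Sum.inl j), X (Sum.inr i) - X (Sum.inr j)} ^ min (d i) (d j)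

/-- `tᵢ` has bidegree `q`, i.e. `(1,0)`, and `xᵢ` has bidegree `t`, i.e. `(0,1)`. -/
def weightTX (n : ℕ) : Fin n ⊕ Fin n → ℕ × ℕ :=
  Sum.elim (fun _ => (1, 0)) (fun _ => (0, 1))

open MvPolynomial in
/-- `J(d₁,d₂) = (a,b)^{d₁} ∩ (c,d)^{d₂} ∩ (a-c,b-d)^{d₁}` in `ℂ[a,b,c,d]`, where `a`, `b`, `c`, `d`
are the variables `X 0`, `X 1`, `X 2`, `X 3`. -/
def J (d₁ d₂ : ℕ) : Ideal (MvPolynomial (Fin 4) ℂ) :=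
  Ideal.span {X 0, X 1} ^ d₁ ⊓ Ideal.span {X 2, X 3} ^ d₂ ⊓
    Ideal.span {X 0 - X 2, X 1 - X 3} ^ d₁

/-- `a` and `c` have bidegree `q`, i.e. `(1,0)`, and `b` and `d` have bidegree `t`, i.e. `(0,1)`. -/
def weightABCD : Fin 4 → ℕ × ℕ := ![(1, 0), (0, 1), (1, 0), (0, 1)]

end

end GenHaiman

/-! Put a = t₁ - t₂, b = x₁ - x₂, c = t₃ - t₂, d = x₃ - x₂. In these coordinates J' is the extension
of J(d₁, d₂) by the two free variables t₂ and x₂ (`JPrime_eq_map`). Hence its Hilbert series is that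
of J(d₁, d₂) divided by (1-q)(1-t), and its minimal generators have the same bidegrees.

Everything then rests on an exact sequence for J(m, n). Substitute a = b = z and c = d = 1 in a
polynomial of bidegree (i, j). The kernel consists of the multiples of ad - bc. This determinant
vanishes to order exactly one along each of the three planes that define J, so the part of the
kernel inside J(m, n) is the determinant times J(m-1, n-1) (`det_mul_mem_J_iff`). The image consists
of the polynomials zᵐ(z-1)ᵐh with deg h ≤ i + j - 2m - n: the three ideals impose zeros at 0, 1 and
∞, and every such polynomial lifts by distributing its linear factors over the two sets of variables
(`exists_polarization`). The resulting recursion in (m, n) for dimensions is `finrank_part_J`.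

The same sequence controls generators. Modulo 𝔪J only the lowest possible degree of each image
survives, so for k ≤ m there is one generator, a multiple of the k-th power of the determinant, in
each bidegree p ≥ (k, k) of total degree 2m + n - k (`finrank_generatingPart_J`). Generators with
different k are told apart by the exact power of the determinant that divides them.

On the other side, H and F are sums over four tableaux. They are evaluated explicitly and shown to
satisfy the same recursions, so the two sides agree by induction. -/

namespace GenHaiman

noncomputable section

/-! ### Power series in two variables given by their coefficients -/

/-- The power series with coefficient `h (i, j)` at `qⁱ tʲ`. -/
def seriesOf (h : ℕ × ℕ → ℚ) : SeriesQT := fun e => h (e 0, e 1)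

theorem coeff_seriesOf (h : ℕ × ℕ → ℚ) (e : Fin 2 →₀ ℕ) :
    MvPowerSeries.coeff e (seriesOf h) = h (e 0, e 1) := rfl

theorem seriesOf_add (g h : ℕ × ℕ → ℚ) : seriesOf g + seriesOf h = seriesOf (fun p => g p + h p) :=
  rfl

theorem monomial_mul_seriesOf (i j : ℕ) (h : ℕ × ℕ → ℚ) :
    MvPowerSeries.X 0 ^ i * MvPowerSeries.X 1 ^ j * seriesOf h =
      seriesOf (fun p => if (i, j) ≤ p then h (p - (i, j)) else 0) := by
  classical
  ext e
  rw [MvPowerSeries.X_pow_eq, MvPowerSeries.X_pow_eq, MvPowerSeries.monomial_mul_monomial,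
    MvPowerSeries.coeff_monomial_mul, coeff_seriesOf, coeff_seriesOf]
  have key : (Finsupp.single 0 i + Finsupp.single 1 j ≤ e) ↔ (i, j) ≤ (e 0, e 1) := by
    rw [Finsupp.le_def, Fin.forall_fin_two]
    simp
  simp only [key]
  split_ifs
  · simp
  · rfl

theorem X_zero_mul_seriesOf (h : ℕ × ℕ → ℚ) :
    (MvPowerSeries.X 0 : SeriesQT) * seriesOf h =
      seriesOf (fun p => if 1 ≤ p.1 then h (p.1 - 1, p.2) else 0) := by
  have := monomial_mul_seriesOf 1 0 h
  simpa [Prod.le_def, Prod.sub_def] using this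

theorem X_one_mul_seriesOf (h : ℕ × ℕ → ℚ) :
    (MvPowerSeries.X 1 : SeriesQT) * seriesOf h =
      seriesOf (fun p => if 1 ≤ p.2 then h (p.1, p.2 - 1) else 0) := by
  have := monomial_mul_seriesOf 0 1 h
  simpa [Prod.le_def, Prod.sub_def] using this

theorem X_pow_mul_X_pow_eq_seriesOf (i j : ℕ) :
    (MvPowerSeries.X 0 ^ i * MvPowerSeries.X 1 ^ j : SeriesQT) =
      seriesOf (fun p => if p = (i, j) then 1 else 0) := by
  classical
  ext e
  rw [MvPowerSeries.X_pow_eq, MvPowerSeries.X_pow_eq, MvPowerSeries.monomial_mul_monomial,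
    MvPowerSeries.coeff_monomial, coeff_seriesOf]
  have key : (e = Finsupp.single 0 i + Finsupp.single 1 j) ↔ (e 0, e 1) = (i, j) := by
    rw [Finsupp.ext_iff, Fin.forall_fin_two]
    simp
  simp only [key, mul_one]

theorem X_zero_pow_eq_seriesOf (s : ℕ) :
    (MvPowerSeries.X 0 ^ s : SeriesQT) = seriesOf (fun p => if p = (s, 0) then 1 else 0) := by
  simpa using X_pow_mul_X_pow_eq_seriesOf s 0

theorem X_one_pow_eq_seriesOf (s : ℕ) :
    (MvPowerSeries.X 1 ^ s : SeriesQT) = seriesOf (fun p => if p = (0, s) then 1 else 0) := by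
  simpa using X_pow_mul_X_pow_eq_seriesOf 0 s

/-- `h_s(q,t) = ∑_{i+j=s} qⁱ tʲ`. -/
def completeSeries (s : ℕ) : SeriesQT := seriesOf fun p => if p.1 + p.2 = s then 1 else 0

theorem completeSeries_eq (s : ℕ) :
    (MvPowerSeries.X 0 - MvPowerSeries.X 1) * completeSeries s =
      MvPowerSeries.X 0 ^ (s + 1) - MvPowerSeries.X 1 ^ (s + 1) := by
  rw [sub_mul, sub_eq_sub_iff_add_eq_add, completeSeries, X_zero_mul_seriesOf, X_one_mul_seriesOf,
    X_zero_pow_eq_seriesOf, X_one_pow_eq_seriesOf, seriesOf_add, seriesOf_add]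
  congr 1
  funext ⟨i, j⟩
  simp only [Prod.mk.injEq]
  rcases i with _ | i <;> rcases j with _ | j <;> simp [add_comm, add_left_comm]

/-- The power series `∑ max(0, i + j + 1 - s) qⁱ tʲ`. -/
def truncatedSeries (s : ℕ) : SeriesQT := seriesOf fun p => ((p.1 + p.2 + 1 - s : ℕ) : ℚ)

/-- Multiplying by q and by t shifts the coefficients to the same function of i + j, so the two
products differ only on the axes (`h1`). On each axis the series is ∑ max(0, i - s) xⁱ, and two
multiplications by 1 - x reduce it to xˢ⁺¹. -/
theorem truncatedSeries_eq (s : ℕ) :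
    (MvPowerSeries.X 0 - MvPowerSeries.X 1) * (1 - MvPowerSeries.X 0) ^ 2 *
        (1 - MvPowerSeries.X 1) ^ 2 * truncatedSeries s =
      MvPowerSeries.X 0 ^ (s + 1) * (1 - MvPowerSeries.X 1) ^ 2 -
        MvPowerSeries.X 1 ^ (s + 1) * (1 - MvPowerSeries.X 0) ^ 2 := by
  have h1 : (MvPowerSeries.X 0 : SeriesQT) * truncatedSeries s +
      seriesOf (fun p => if p.1 = 0 then ((p.2 - s : ℕ) : ℚ) else 0) =
      MvPowerSeries.X 1 * truncatedSeries s +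
      seriesOf (fun p => if p.2 = 0 then ((p.1 - s : ℕ) : ℚ) else 0) := by
    rw [truncatedSeries, X_zero_mul_seriesOf, X_one_mul_seriesOf, seriesOf_add, seriesOf_add]
    congr 1
    funext ⟨i, j⟩
    rcases i with _ | i <;> rcases j with _ | j <;> simp [add_comm, add_left_comm]
  have h2 : seriesOf (fun p => if p.2 = 0 then ((p.1 - s : ℕ) : ℚ) else 0) =
      MvPowerSeries.X 0 * seriesOf (fun p => if p.2 = 0 then ((p.1 - s : ℕ) : ℚ) else 0) +
      seriesOf (fun p => if p.2 = 0 ∧ s + 1 ≤ p.1 then 1 else 0) := by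
    rw [X_zero_mul_seriesOf, seriesOf_add]
    congr 1
    funext ⟨i, j⟩
    rcases i with _ | i <;> rcases j with _ | j <;> simp
    split_ifs with h
    · rw [Nat.sub_add_comm h]; push_cast; ring
    · simp [Nat.sub_eq_zero_of_le (show i + 1 ≤ s by omega), Nat.sub_eq_zero_of_le
        (show i ≤ s by omega)]
  have h3 : seriesOf (fun p => if p.2 = 0 ∧ s + 1 ≤ p.1 then 1 else 0) =
      MvPowerSeries.X 0 * seriesOf (fun p => if p.2 = 0 ∧ s + 1 ≤ p.1 then 1 else 0) +
      MvPowerSeries.X 0 ^ (s + 1) := by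
    rw [X_zero_mul_seriesOf, X_zero_pow_eq_seriesOf, seriesOf_add]
    congr 1
    funext ⟨i, j⟩
    rcases i with _ | i <;> rcases j with _ | j <;> simp
    split_ifs <;> first | omega | simp
  have h4 : seriesOf (fun p => if p.1 = 0 then ((p.2 - s : ℕ) : ℚ) else 0) =
      MvPowerSeries.X 1 * seriesOf (fun p => if p.1 = 0 then ((p.2 - s : ℕ) : ℚ) else 0) +
      seriesOf (fun p => if p.1 = 0 ∧ s + 1 ≤ p.2 then 1 else 0) := by
    rw [X_one_mul_seriesOf, seriesOf_add]
    congr 1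
    funext ⟨i, j⟩
    rcases i with _ | i <;> rcases j with _ | j <;> simp
    split_ifs with h
    · rw [Nat.sub_add_comm h]; push_cast; ring
    · simp [Nat.sub_eq_zero_of_le (show j + 1 ≤ s by omega), Nat.sub_eq_zero_of_le
        (show j ≤ s by omega)]
  have h5 : seriesOf (fun p => if p.1 = 0 ∧ s + 1 ≤ p.2 then 1 else 0) =
      MvPowerSeries.X 1 * seriesOf (fun p => if p.1 = 0 ∧ s + 1 ≤ p.2 then 1 else 0) +
      MvPowerSeries.X 1 ^ (s + 1) := by
    rw [X_one_mul_seriesOf, X_one_pow_eq_seriesOf, seriesOf_add]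
    congr 1
    funext ⟨i, j⟩
    rcases i with _ | i <;> rcases j with _ | j <;> simp
    split_ifs <;> first | omega | simp
  set x : SeriesQT := MvPowerSeries.X 0
  set y : SeriesQT := MvPowerSeries.X 1
  linear_combination (1 - x) ^ 2 * (1 - y) ^ 2 * h1 + (1 - y) ^ 2 * (1 - x) * h2 +
    (1 - y) ^ 2 * h3 - (1 - x) ^ 2 * (1 - y) * h4 - (1 - x) ^ 2 * h5

/-! ### Rational function identities -/

/-- `q` and `t` satisfy none of the multiplicative relations that would make a denominator of the
rational functions below vanish. -/
structure Generic {K : Type*} [Field K] (q t : K) : Prop where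
  q_ne_zero : q ≠ 0
  t_ne_zero : t ≠ 0
  q_ne_one : q ≠ 1
  t_ne_one : t ≠ 1
  q_sq_ne_one : q ^ 2 ≠ 1
  t_sq_ne_one : t ^ 2 ≠ 1
  mul_ne_one : q * t ≠ 1
  q_ne_t : q ≠ t
  q_sq_ne_t : q ^ 2 ≠ t
  t_sq_ne_q : t ^ 2 ≠ q

theorem generic_q_t : Generic q t := by
  have inj := IsFractionRing.injective (MvPolynomial (Fin 2) ℚ) RatQT
  -- The point (q, t) = (2, 3) satisfies none of the excluded relations, so evaluating there
  -- separates all the polynomials in question.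
  have key : ∀ f g : MvPolynomial (Fin 2) ℚ,
      MvPolynomial.eval ![2, 3] f ≠ MvPolynomial.eval ![2, 3] g →
      algebraMap (MvPolynomial (Fin 2) ℚ) RatQT f ≠ algebraMap (MvPolynomial (Fin 2) ℚ) RatQT g :=
    fun f g h e => h (by rw [inj e])
  constructor
  · simpa only [q, map_zero] using key (.X 0) 0 (by simp)
  · simpa only [t, map_zero] using key (.X 1) 0 (by simp)
  · simpa only [q, map_one] using key (.X 0) 1 (by simp)
  · simpa only [t, map_one] using key (.X 1) 1 (by simp)
  · simpa only [q, pow_two, map_one, map_mul] using key (.X 0 * .X 0) 1 (by simp; norm_num)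
  · simpa only [t, pow_two, map_one, map_mul] using key (.X 1 * .X 1) 1 (by simp; norm_num)
  · simpa only [q, t, map_one, map_mul] using key (.X 0 * .X 1) 1 (by simp; norm_num)
  · simpa only [q, t] using key (.X 0) (.X 1) (by simp)
  · simpa only [q, t, pow_two, map_mul] using key (.X 0 * .X 0) (.X 1) (by simp; norm_num)
  · simpa only [q, t, pow_two, map_mul] using key (.X 1 * .X 1) (.X 0) (by simp; norm_num)

theorem Generic.map {K L : Type*} [Field K] [Field L] {q t : K} (h : Generic q t) (f : K →+* L) :
    Generic (f q) (f t) := by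
  have inj := f.injective
  constructor
  · simpa using h.1
  · simpa using h.2
  · simpa using inj.ne h.3
  · simpa using inj.ne h.4
  · simpa using inj.ne h.5
  · simpa using inj.ne h.6
  · simpa using inj.ne h.7
  · simpa using inj.ne h.8
  · simpa using inj.ne h.9
  · simpa using inj.ne h.10

section

variable {K : Type*} [Field K] (q t : K)

/-- The rational function that is the Hilbert series of `J(m, n)`. -/
def hilbertRat (m n : ℕ) : K :=
  q ^ (2 * m + n) / ((1 - q) ^ 2 * (1 - t / q) * (1 - t / q ^ 2)) +
    t ^ (2 * m + n) / ((1 - t) ^ 2 * (1 - q / t) * (1 - q / t ^ 2)) +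
    q ^ m * t ^ n * (1 + t) / ((1 - q) * (1 - t) * (1 - q / t) * (1 - t ^ 2 / q)) +
    q ^ n * t ^ m * (1 + q) / ((1 - t) * (1 - q) * (1 - t / q) * (1 - q ^ 2 / t))

/-- The rational function that is the Hilbert series of `J(m, n) / 𝔪 J(m, n)`. -/
def generatingRat (m n : ℕ) : K :=
  q ^ (2 * m + n) / ((1 - t / q) * (1 - t / q ^ 2)) +
    t ^ (2 * m + n) / ((1 - q / t) * (1 - q / t ^ 2)) +
    q ^ m * t ^ n / ((1 - q / t) * (1 - t ^ 2 / q)) +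
    q ^ n * t ^ m / ((1 - t / q) * (1 - q ^ 2 / t))

variable {q t}

theorem Generic.one_sub_ne (h : Generic q t) :
    1 - q ≠ 0 ∧ 1 - t ≠ 0 ∧ q - t ≠ 0 ∧ t - q ≠ 0 ∧ q ^ 2 - t ≠ 0 ∧ t ^ 2 - q ≠ 0 ∧ t - q ^ 2 ≠ 0 ∧
      q - t ^ 2 ≠ 0 :=
  ⟨sub_ne_zero.2 h.3.symm, sub_ne_zero.2 h.4.symm, sub_ne_zero.2 h.8, sub_ne_zero.2 h.8.symm,
    sub_ne_zero.2 h.9, sub_ne_zero.2 h.10, sub_ne_zero.2 h.9.symm, sub_ne_zero.2 h.10.symm⟩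

/-- Clears the nested fractions, so that all denominators are products of 1 - q, 1 - t, q - t, q² -
t and t² - q. -/
theorem hilbertRat_eq (h : Generic q t) (m n : ℕ) :
    hilbertRat q t m n =
      q ^ (2 * m + n) * q ^ 3 / ((1 - q) ^ 2 * (q - t) * (q ^ 2 - t)) -
      t ^ (2 * m + n) * t ^ 3 / ((1 - t) ^ 2 * (q - t) * (t ^ 2 - q)) +
      q ^ m * t ^ n * (1 + t) * (q * t) / ((1 - q) * (1 - t) * (q - t) * (t ^ 2 - q)) -
      q ^ n * t ^ m * (1 + q) * (q * t) / ((1 - t) * (1 - q) * (q - t) * (q ^ 2 - t)) := by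
  obtain ⟨h1, h2, h3, h4, h5, h6, h7, h8⟩ := h.one_sub_ne
  have hq := h.1
  have ht := h.2
  have e1 : 1 - t / q = (q - t) / q := by field_simp
  have e2 : 1 - t / q ^ 2 = (q ^ 2 - t) / q ^ 2 := by field_simp
  have e3 : 1 - q / t = - (q - t) / t := by field_simp; ring
  have e4 : 1 - q / t ^ 2 = (t ^ 2 - q) / t ^ 2 := by field_simp
  have e5 : 1 - t ^ 2 / q = - (t ^ 2 - q) / q := by field_simp; ring
  have e6 : 1 - q ^ 2 / t = - (q ^ 2 - t) / t := by field_simp; ring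
  rw [hilbertRat, e1, e2, e3, e4, e5, e6]
  -- The two sides agree term by term with the denominators left opaque, so their relations to q and
  -- t can be forgotten.
  generalize q - t = a at *
  generalize q ^ 2 - t = b at *
  generalize t ^ 2 - q = c at *
  generalize 1 - q = d at *
  generalize 1 - t = e at *
  generalize q ^ (2 * m + n) = A at *
  generalize t ^ (2 * m + n) = A at *
  field_simp
  ring

theorem generatingRat_eq (h : Generic q t) (m n : ℕ) :
    generatingRat q t m n =
      q ^ (2 * m + n) * q ^ 3 / ((q - t) * (q ^ 2 - t)) -
      t ^ (2 * m + n) * t ^ 3 / ((q - t) * (t ^ 2 - q)) +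
      q ^ m * t ^ n * (q * t) / ((q - t) * (t ^ 2 - q)) -
      q ^ n * t ^ m * (q * t) / ((q - t) * (q ^ 2 - t)) := by
  obtain ⟨h1, h2, h3, h4, h5, h6, h7, h8⟩ := h.one_sub_ne
  have hq := h.1
  have ht := h.2
  have e1 : 1 - t / q = (q - t) / q := by field_simp
  have e2 : 1 - t / q ^ 2 = (q ^ 2 - t) / q ^ 2 := by field_simp
  have e3 : 1 - q / t = - (q - t) / t := by field_simp; ring
  have e4 : 1 - q / t ^ 2 = (t ^ 2 - q) / t ^ 2 := by field_simp
  have e5 : 1 - t ^ 2 / q = - (t ^ 2 - q) / q := by field_simp; ring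
  have e6 : 1 - q ^ 2 / t = - (q ^ 2 - t) / t := by field_simp; ring
  rw [generatingRat, e1, e2, e3, e4, e5, e6]
  generalize q - t = a at *
  generalize q ^ 2 - t = b at *
  generalize t ^ 2 - q = c at *
  generalize q ^ (2 * m + n) = A at *
  generalize t ^ (2 * m + n) = A at *
  field_simp
  ring

/-- The mixed terms are multiplied by qt when m and n both grow by one, so they cancel. In the pure
terms the factor q³ - qt cancels the denominator q² - t, and likewise for t. What remains is the
right side of `truncatedSeries_eq` for s = 2(m+1) + (n+1). -/
theorem hilbertRat_succ_succ (h : Generic q t) (m n : ℕ) :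
    (q - t) * (1 - q) ^ 2 * (1 - t) ^ 2 *
        (hilbertRat q t (m + 1) (n + 1) - q * t * hilbertRat q t m n) =
      q ^ (2 * m + n + 4) * (1 - t) ^ 2 - t ^ (2 * m + n + 4) * (1 - q) ^ 2 := by
  obtain ⟨h1, h2, h3, h4, h5, h6, h7, h8⟩ := h.one_sub_ne
  rw [hilbertRat_eq h, hilbertRat_eq h]
  rw [show 2 * (m + 1) + (n + 1) = (2 * m + n) + 3 by ring, pow_add q (2 * m + n),
    pow_add t (2 * m + n),
    pow_add q (2 * m + n), pow_add t (2 * m + n), pow_succ q m, pow_succ t m,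
    pow_succ q n, pow_succ t n]
  generalize q ^ (2 * m + n) = A
  generalize t ^ (2 * m + n) = B
  generalize q ^ m = C
  generalize q ^ n = D
  generalize t ^ m = E
  generalize t ^ n = F
  field_simp
  ring

/-- The recursion at the boundary: the first index stays 0, in accordance with the truncated m - 1
in `partSeries_J`. -/
theorem hilbertRat_zero_succ (h : Generic q t) (n : ℕ) :
    (q - t) * (1 - q) ^ 2 * (1 - t) ^ 2 *
        (hilbertRat q t 0 (n + 1) - q * t * hilbertRat q t 0 n) =
      q ^ (n + 2) * (1 - t) ^ 2 - t ^ (n + 2) * (1 - q) ^ 2 := by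
  obtain ⟨h1, h2, h3, h4, h5, h6, h7, h8⟩ := h.one_sub_ne
  rw [hilbertRat_eq h, hilbertRat_eq h]
  simp only [mul_zero, zero_add, pow_zero, mul_one, one_mul, pow_add]
  generalize q ^ n = D
  generalize t ^ n = F
  field_simp
  ring

theorem hilbertRat_zero_zero (h : Generic q t) :
    (q - t) * (1 - q) ^ 2 * (1 - t) ^ 2 *
        (hilbertRat q t 0 0 - q * t * hilbertRat q t 0 0) =
      q ^ 1 * (1 - t) ^ 2 - t ^ 1 * (1 - q) ^ 2 := by
  obtain ⟨h1, h2, h3, h4, h5, h6, h7, h8⟩ := h.one_sub_ne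
  rw [hilbertRat_eq h]
  simp only [mul_zero, zero_add, pow_zero, mul_one, one_mul]
  field_simp
  ring

theorem generatingRat_succ_succ (h : Generic q t) (m n : ℕ) :
    (q - t) * (generatingRat q t (m + 1) (n + 1) - q * t * generatingRat q t m n) =
      q ^ (2 * m + n + 4) - t ^ (2 * m + n + 4) := by
  obtain ⟨h1, h2, h3, h4, h5, h6, h7, h8⟩ := h.one_sub_ne
  rw [generatingRat_eq h, generatingRat_eq h]
  rw [show 2 * (m + 1) + (n + 1) = (2 * m + n) + 3 by ring, pow_add q (2 * m + n),
    pow_add t (2 * m + n),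
    pow_add q (2 * m + n), pow_add t (2 * m + n), pow_succ q m, pow_succ t m,
    pow_succ q n, pow_succ t n]
  generalize q ^ (2 * m + n) = A
  generalize t ^ (2 * m + n) = B
  generalize q ^ m = C
  generalize q ^ n = D
  generalize t ^ m = E
  generalize t ^ n = F
  field_simp
  ring

theorem generatingRat_zero (h : Generic q t) (n : ℕ) :
    (q - t) * generatingRat q t 0 n = q ^ (n + 1) - t ^ (n + 1) := by
  obtain ⟨h1, h2, h3, h4, h5, h6, h7, h8⟩ := h.one_sub_ne
  rw [generatingRat_eq h]
  simp only [mul_zero, zero_add, pow_zero, mul_one, one_mul, pow_add]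
  generalize q ^ n = D
  generalize t ^ n = F
  field_simp
  ring

end

open MvPolynomial

/-! ### Bigraded pieces of ideals of polynomial rings -/

section Graded

variable {σ : Type*} (w : σ → ℕ × ℕ)

section
attribute [local instance] MvPolynomial.weightedGradedAlgebra

variable {w}

theorem weightedHomogeneousComponent_mul {a : MvPolynomial σ ℂ} {e : ℕ × ℕ}
    (ha : IsWeightedHomogeneous w a e) (b : MvPolynomial σ ℂ) (p : ℕ × ℕ) :
    weightedHomogeneousComponent w p (a * b) =
      if e ≤ p then a * weightedHomogeneousComponent w (p - e) b else 0 := by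
  have h := DirectSum.coe_decompose_mul_of_left_mem (weightedHomogeneousSubmodule ℂ w) (b := b) p
    (i := e) ha
  have key : ∀ (f : MvPolynomial σ ℂ) (m : ℕ × ℕ),
      (DirectSum.decompose (weightedHomogeneousSubmodule ℂ w) f m : MvPolynomial σ ℂ) =
        weightedHomogeneousComponent w m f := weightedDecomposition.decompose'_apply ℂ w
  rwa [key, key] at h

/-- The ideal `I` contains the homogeneous components of its elements. -/
def IsBihomogeneous (w : σ → ℕ × ℕ) (I : Ideal (MvPolynomial σ ℂ)) : Prop :=
  I.IsHomogeneous (weightedHomogeneousSubmodule ℂ w)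

theorem IsBihomogeneous.component_mem {I : Ideal (MvPolynomial σ ℂ)} (h : IsBihomogeneous w I)
    {f : MvPolynomial σ ℂ} (hf : f ∈ I) (p : ℕ × ℕ) : weightedHomogeneousComponent w p f ∈ I :=
  weightedHomogeneousComponent_mem_of_mem ℂ w h hf p

theorem IsBihomogeneous.inf {I K : Ideal (MvPolynomial σ ℂ)} (hI : IsBihomogeneous w I)
    (hK : IsBihomogeneous w K) : IsBihomogeneous w (I ⊓ K) :=
  Ideal.IsHomogeneous.inf hI hK

theorem IsBihomogeneous.pow {I : Ideal (MvPolynomial σ ℂ)} (hI : IsBihomogeneous w I) (n : ℕ) :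
    IsBihomogeneous w (I ^ n) := by
  induction n with
  | zero => simpa [IsBihomogeneous] using Ideal.IsHomogeneous.top _
  | succ n ih => rw [pow_succ]; exact Ideal.IsHomogeneous.mul ih hI

theorem isBihomogeneous_span_pair {a b : MvPolynomial σ ℂ} {e e' : ℕ × ℕ}
    (ha : IsWeightedHomogeneous w a e) (hb : IsWeightedHomogeneous w b e') :
    IsBihomogeneous w (Ideal.span {a, b}) := by
  apply Ideal.homogeneous_span
  rintro x (rfl | rfl)
  exacts [⟨_, ha⟩, ⟨_, hb⟩]

end

theorem isWeightedHomogeneous_of_mul_left {w : σ → ℕ × ℕ} {a b : MvPolynomial σ ℂ} {e p : ℕ × ℕ}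
    (ha : IsWeightedHomogeneous w a e) (ha0 : a ≠ 0) (hab : IsWeightedHomogeneous w (a * b) p) :
    b = 0 ∨ e ≤ p ∧ IsWeightedHomogeneous w b (p - e) := by
  have h := weightedHomogeneousComponent_mul ha b p
  rw [hab.weightedHomogeneousComponent_same] at h
  split_ifs at h with hep
  · right
    rw [mul_right_inj' ha0] at h
    refine ⟨hep, ?_⟩
    rw [h]
    exact weightedHomogeneousComponent_isWeightedHomogeneous (w := w) (p - e) b
  · left
    simpa [ha0] using h

/-- The homogeneous elements of bidegree `p` of the ideal `I`. -/
def part (I : Ideal (MvPolynomial σ ℂ)) (p : ℕ × ℕ) : Submodule ℂ (MvPolynomial σ ℂ) :=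
  I.restrictScalars ℂ ⊓ weightedHomogeneousSubmodule ℂ w p

theorem mem_part {w : σ → ℕ × ℕ} {I : Ideal (MvPolynomial σ ℂ)} {p : ℕ × ℕ} {f : MvPolynomial σ ℂ} :
    f ∈ part w I p ↔ f ∈ I ∧ IsWeightedHomogeneous w f p := Iff.rfl

theorem map_subtype_idealPiece (I : Ideal (MvPolynomial σ ℂ)) (p : ℕ × ℕ) :
    (idealPiece w I p).map (I.subtype.restrictScalars ℂ) = part w I p := by
  ext f
  simp only [Submodule.mem_map, mem_part]
  constructor
  · rintro ⟨y, hy, rfl⟩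
    exact ⟨y.2, hy⟩
  · rintro ⟨h1, h2⟩
    exact ⟨⟨f, h1⟩, h2, rfl⟩

theorem finrank_idealPiece (I : Ideal (MvPolynomial σ ℂ)) (p : ℕ × ℕ) :
    Module.finrank ℂ (idealPiece w I p) = Module.finrank ℂ (part w I p) := by
  rw [← map_subtype_idealPiece]
  exact (LinearEquiv.finrank_eq
    (Submodule.equivMapOfInjective (I.subtype.restrictScalars ℂ) Subtype.val_injective _))

/-- `𝔪 I` as a complex vector space. -/
def maxMul (I : Ideal (MvPolynomial σ ℂ)) : Submodule ℂ (MvPolynomial σ ℂ) :=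
  (maxIdeal σ * I).restrictScalars ℂ

theorem mem_maxMul {I : Ideal (MvPolynomial σ ℂ)} {f : MvPolynomial σ ℂ} :
    f ∈ maxMul I ↔ f ∈ maxIdeal σ * I := Iff.rfl

/-- The image of the piece of bidegree `p` of `I` modulo `𝔪 I`. -/
def generatingPart (I : Ideal (MvPolynomial σ ℂ)) (p : ℕ × ℕ) :
    Submodule ℂ (MvPolynomial σ ℂ ⧸ maxMul I) :=
  (part w I p).map (maxMul I).mkQ

theorem mem_maxIdeal_smul_top_iff {I : Ideal (MvPolynomial σ ℂ)} (y : I) :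
    y ∈ (maxIdeal σ • ⊤ : Submodule (MvPolynomial σ ℂ) I) ↔
      (y : MvPolynomial σ ℂ) ∈ maxIdeal σ * I := by
  have h : (maxIdeal σ • ⊤ : Submodule (MvPolynomial σ ℂ) I).map I.subtype = maxIdeal σ * I := by
    rw [Submodule.map_smul'', Submodule.map_top, Submodule.range_subtype, smul_eq_mul]
  rw [← h]
  exact ⟨fun hy => ⟨y, hy, rfl⟩, fun ⟨z, hz, e⟩ => Subtype.ext e ▸ hz⟩

/-- The quotient I/𝔪I embeds in the polynomial ring modulo 𝔪I, so generators can be counted without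
leaving the ambient ring. -/
theorem finrank_generatingPiece (I : Ideal (MvPolynomial σ ℂ)) (p : ℕ × ℕ) :
    Module.finrank ℂ (generatingPiece w I p) = Module.finrank ℂ (generatingPart w I p) := by
  let N : Submodule (MvPolynomial σ ℂ) I := maxIdeal σ • ⊤
  let g : I →ₗ[ℂ] MvPolynomial σ ℂ ⧸ maxMul I := (maxMul I).mkQ ∘ₗ I.subtype.restrictScalars ℂ
  have hN : ∀ y : I, y ∈ N.restrictScalars ℂ ↔ g y = 0 := fun y => by
    rw [Submodule.restrictScalars_mem, mem_maxIdeal_smul_top_iff]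
    exact (Submodule.Quotient.mk_eq_zero _).symm
  let φ : (I ⧸ N.restrictScalars ℂ) →ₗ[ℂ] MvPolynomial σ ℂ ⧸ maxMul I :=
    (N.restrictScalars ℂ).liftQ g fun y hy => (hN y).1 hy
  have hφ : Function.Injective φ := by
    rw [injective_iff_map_eq_zero]
    intro x hx
    obtain ⟨y, rfl⟩ := Submodule.Quotient.mk_surjective _ x
    exact (Submodule.Quotient.mk_eq_zero _).2 ((hN y).2 hx)
  have hmap : generatingPart w I p = (generatingPiece w I p).map
      (φ ∘ₗ (Submodule.Quotient.restrictScalarsEquiv ℂ N).symm.toLinearMap) := by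
    rw [generatingPart, ← map_subtype_idealPiece, generatingPiece, ← Submodule.map_comp,
      ← Submodule.map_comp]
    rfl
  rw [hmap]
  refine (LinearEquiv.finrank_eq (Submodule.equivMapOfInjective _ ?_ _))
  exact hφ.comp (Submodule.Quotient.restrictScalarsEquiv ℂ N).symm.injective

/-- Rank-nullity for an exact sequence 0 → P' → P → f(P) → 0. Finiteness of P is part of the
conclusion because it feeds the inductions on bidegree. -/
theorem finrank_of_ker_eq_map {V W : Type*} [AddCommGroup V] [Module ℂ V] [AddCommGroup W]
    [Module ℂ W] {U : Type*} [AddCommGroup U] [Module ℂ U] (P : Submodule ℂ V) (f : V →ₗ[ℂ] W)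
    (g : U →ₗ[ℂ] V) (hg : Function.Injective g) (P' : Submodule ℂ U)
    (h : P ⊓ LinearMap.ker f = P'.map g) [FiniteDimensional ℂ P'] [FiniteDimensional ℂ (P.map f)] :
    FiniteDimensional ℂ P ∧
      Module.finrank ℂ P = Module.finrank ℂ (P.map f) + Module.finrank ℂ P' := by
  have hP : FiniteDimensional ℂ P := by
    rw [← Submodule.fg_iff_finiteDimensional]
    apply Submodule.fg_of_fg_map_of_fg_inf_ker f
    · exact (Submodule.fg_iff_finiteDimensional _).2 inferInstance
    · rw [h]
      exact ((Submodule.fg_iff_finiteDimensional _).2 inferInstance).map _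
  refine ⟨hP, ?_⟩
  rw [← LinearMap.finrank_range_add_finrank_ker (f.domRestrict P)]
  congr 1
  · rw [LinearMap.range_domRestrict]
  · have e1 := (Submodule.equivMapOfInjective g hg P').finrank_eq
    rw [e1, ← h]
    have e2 := (Submodule.equivMapOfInjective P.subtype P.injective_subtype
      (LinearMap.ker (f.domRestrict P))).finrank_eq
    rw [e2]
    congr 2
    all_goals
      ext x
      simp [and_comm]

/-- Two graded ideals related by an equivariant retraction that is an isomorphism modulo `𝔪`
have the same numbers of generators. -/
theorem finrank_generatingPart_of_retract {τ : Type*} {w' : τ → ℕ × ℕ} {w : σ → ℕ × ℕ}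
    {I : Ideal (MvPolynomial σ ℂ)} {I' : Ideal (MvPolynomial τ ℂ)}
    (ι : MvPolynomial σ ℂ →ₐ[ℂ] MvPolynomial τ ℂ) (κ : MvPolynomial τ ℂ →ₐ[ℂ] MvPolynomial σ ℂ)
    (hκι : ∀ f, κ (ι f) = f)
    (hι : ∀ p, ∀ f ∈ part w I p, ι f ∈ part w' I' p)
    (hκ : ∀ p, ∀ f ∈ part w' I' p, κ f ∈ part w I p)
    (hιm : ∀ f ∈ maxIdeal σ * I, ι f ∈ maxIdeal τ * I')
    (hκm : ∀ f ∈ maxIdeal τ * I', κ f ∈ maxIdeal σ * I)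
    (h : ∀ f ∈ I', f - ι (κ f) ∈ maxIdeal τ * I') (p : ℕ × ℕ) :
    Module.finrank ℂ (generatingPart w' I' p) = Module.finrank ℂ (generatingPart w I p) := by
  let g : (MvPolynomial σ ℂ ⧸ maxMul I) →ₗ[ℂ] MvPolynomial τ ℂ ⧸ maxMul I' :=
    (maxMul I).mapQ (maxMul I') ι.toLinearMap fun f hf => hιm f hf
  have hg : Function.Injective g := by
    rw [injective_iff_map_eq_zero]
    intro x hx
    obtain ⟨f, rfl⟩ := Submodule.Quotient.mk_surjective _ x
    refine (Submodule.Quotient.mk_eq_zero _).2 ?_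
    have := hκm _ ((Submodule.Quotient.mk_eq_zero _).1 hx)
    rw [AlgHom.toLinearMap_apply, hκι] at this
    exact this
  have hmap : generatingPart w' I' p = (generatingPart w I p).map g := by
    apply le_antisymm
    · rintro _ ⟨f, hf, rfl⟩
      refine ⟨_, ⟨κ f, hκ p f hf, rfl⟩, ?_⟩
      exact ((Submodule.Quotient.eq _).2 (h f hf.1)).symm
    · rintro _ ⟨_, ⟨f, hf, rfl⟩, rfl⟩
      exact ⟨ι f, hι p f hf, rfl⟩
  rw [hmap]
  exact (LinearEquiv.finrank_eq (Submodule.equivMapOfInjective _ hg _)).symm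

/-- A morphism of algebras that sends each variable to a homogeneous element of the same bidegree
preserves bidegrees. -/
theorem isWeightedHomogeneous_map_algHom {τ : Type*} {w' : τ → ℕ × ℕ} {w : σ → ℕ × ℕ}
    (φ : MvPolynomial σ ℂ →ₐ[ℂ] MvPolynomial τ ℂ)
    (hφ : ∀ s, IsWeightedHomogeneous w' (φ (X s)) (w s)) {f : MvPolynomial σ ℂ} {p : ℕ × ℕ}
    (hf : IsWeightedHomogeneous w f p) : IsWeightedHomogeneous w' (φ f) p := by
  rw [f.as_sum, map_sum]
  refine IsWeightedHomogeneous.sum _ _ _ fun m hm => ?_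
  have hm' := hf (mem_support_iff.1 hm)
  rw [monomial_eq, map_mul, ← algebraMap_eq, AlgHom.commutes, algebraMap_eq, Finsupp.prod, map_prod]
  apply IsWeightedHomogeneous.C_mul
  rw [← hm', Finsupp.weight_apply, Finsupp.sum]
  apply IsWeightedHomogeneous.prod
  intro s _
  rw [map_pow]
  exact (hφ s).pow _

theorem map_maxIdeal_mul_le {τ : Type*} {I : Ideal (MvPolynomial σ ℂ)}
    {I' : Ideal (MvPolynomial τ ℂ)} (φ : MvPolynomial σ ℂ →ₐ[ℂ] MvPolynomial τ ℂ)
    (hφ : ∀ s, φ (X s) ∈ maxIdeal τ) (hI : ∀ f ∈ I, φ f ∈ I') :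
    ∀ f ∈ maxIdeal σ * I, φ f ∈ maxIdeal τ * I' := by
  suffices h : maxIdeal σ * I ≤ (maxIdeal τ * I').comap φ from h
  rw [← Ideal.map_le_iff_le_comap, Ideal.map_mul]
  refine Ideal.mul_mono ?_ (Ideal.map_le_iff_le_comap.2 hI)
  rw [maxIdeal, Ideal.map_span, Ideal.span_le]
  rintro _ ⟨_, ⟨s, rfl⟩, rfl⟩
  exact hφ s

theorem X_mem_maxIdeal (s : σ) : X s ∈ maxIdeal σ := Ideal.subset_span ⟨s, rfl⟩

end Graded

/-! ### Orders of vanishing along linear subspaces -/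

/-- Let `τ` be a deformation of the identity with values in the Rees algebra of `I` that sends `I`
to multiples of the parameter. Then `Iᵐ` is the ideal of elements of order at least `m`. -/
theorem mem_pow_iff_X_pow_dvd {R : Type*} [CommRing R] {I : Ideal R} (τ : R →+* Polynomial R)
    (h1 : ∀ f, (τ f).eval 1 = f) (hrees : ∀ f, τ f ∈ reesAlgebra I)
    (hI : ∀ f ∈ I, Polynomial.X ∣ τ f) (m : ℕ) (f : R) :
    f ∈ I ^ m ↔ Polynomial.X ^ m ∣ τ f := by
  constructor
  · intro hf
    have hle : I.map τ ≤ Ideal.span {Polynomial.X} :=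
      Ideal.map_le_iff_le_comap.2 fun x hx => Ideal.mem_span_singleton.2 (hI x hx)
    rw [← Ideal.mem_span_singleton, ← Ideal.span_singleton_pow]
    apply Ideal.pow_right_mono hle m
    rw [← Ideal.map_pow]
    exact Ideal.mem_map_of_mem τ hf
  · intro hf
    rw [← h1 f, Polynomial.eval_eq_sum, Polynomial.sum]
    refine Ideal.sum_mem _ fun k _ => ?_
    rw [one_pow, mul_one]
    rcases lt_or_ge k m with hk | hk
    · rw [Polynomial.X_pow_dvd_iff.1 hf k hk]
      exact Ideal.zero_mem _
    · exact Ideal.pow_le_pow_right hk (hrees f k)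

theorem mul_mem_pow_iff {R : Type*} [CommRing R] [IsDomain R] {I : Ideal R} (τ : R →+* Polynomial R)
    (h1 : ∀ f, (τ f).eval 1 = f) (hrees : ∀ f, τ f ∈ reesAlgebra I)
    (hI : ∀ f ∈ I, Polynomial.X ∣ τ f) {D : R} (hD : D ≠ 0)
    (hτD : τ D = Polynomial.X * Polynomial.C D) (m : ℕ) (f : R) :
    D * f ∈ I ^ m ↔ f ∈ I ^ (m - 1) := by
  rw [mem_pow_iff_X_pow_dvd τ h1 hrees hI, mem_pow_iff_X_pow_dvd τ h1 hrees hI, map_mul, hτD]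
  rcases m with _ | m
  · simp
  rw [pow_succ', mul_assoc, mul_dvd_mul_iff_left Polynomial.X_ne_zero, Nat.add_sub_cancel]
  refine ⟨fun h => Polynomial.prime_X.pow_dvd_of_dvd_mul_left m ?_ h, fun h => h.mul_left _⟩
  rw [Polynomial.X_dvd_iff, Polynomial.coeff_C_zero]
  exact hD

/-- The ring `ℂ[a, b, c, d]`. -/
abbrev PolyABCD : Type := MvPolynomial (Fin 4) ℂ

/-- The determinant `ad - bc`. -/
def det : PolyABCD := X 0 * X 3 - X 1 * X 2

theorem det_ne_zero : det ≠ 0 := by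
  intro h
  have := congrArg (MvPolynomial.eval ![1, 0, 0, 1]) h
  simp [det] at this

/-- The deformation is the substitution `v`. Since the Rees algebra is a subalgebra, its conditions
need checking on the four variables only. -/
theorem det_mul_mem_span_pow_iff {x y : PolyABCD} (v : Fin 4 → Polynomial PolyABCD)
    (h1 : ∀ s, (v s).eval 1 = X s) (hrees : ∀ s, v s ∈ reesAlgebra (Ideal.span {x, y}))
    (hx : Polynomial.X ∣ aeval v x) (hy : Polynomial.X ∣ aeval v y)
    (hdet : v 0 * v 3 - v 1 * v 2 = Polynomial.X * Polynomial.C det) (m : ℕ) (f : PolyABCD) :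
    det * f ∈ Ideal.span {x, y} ^ m ↔ f ∈ Ideal.span {x, y} ^ (m - 1) := by
  refine mul_mem_pow_iff (aeval v : PolyABCD →ₐ[ℂ] Polynomial PolyABCD).toRingHom ?_ ?_ ?_
    det_ne_zero ?_ m f
  · intro f
    have : (Polynomial.evalRingHom (1 : PolyABCD)).comp
        (aeval v : PolyABCD →ₐ[ℂ] Polynomial PolyABCD).toRingHom = RingHom.id _ := by
      apply MvPolynomial.ringHom_ext
      · intro r
        simp
      · intro s
        simpa using h1 s
    exact congrArg (fun g : PolyABCD →+* PolyABCD => g f) this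
  · intro f
    change aeval v f ∈ _
    induction f using MvPolynomial.induction_on with
    | C r =>
      rw [← algebraMap_eq, AlgHom.commutes, IsScalarTower.algebraMap_apply ℂ PolyABCD]
      exact (reesAlgebra (Ideal.span {x, y})).algebraMap_mem _
    | add f g hf hg => rw [map_add]; exact add_mem hf hg
    | mul_X f s hf => rw [map_mul, aeval_X]; exact mul_mem hf (hrees s)
  · suffices h : Ideal.span {x, y} ≤
      (Ideal.span {Polynomial.X}).comap (aeval v : PolyABCD →ₐ[ℂ] Polynomial PolyABCD) from
      fun f hf => Ideal.mem_span_singleton.1 (h hf)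
    rw [Ideal.span_le]
    rintro z (rfl | rfl)
    exacts [Ideal.mem_span_singleton.2 hx, Ideal.mem_span_singleton.2 hy]
  · rw [← hdet]
    simp [det]

theorem C_mul_X_mem_reesAlgebra {R : Type*} [CommRing R] {I : Ideal R} {r : R} (hr : r ∈ I) :
    Polynomial.C r * Polynomial.X ∈ reesAlgebra I := by
  rw [Polynomial.C_mul_X_eq_monomial]
  exact reesAlgebra.monomial_mem.2 (by simpa using hr)

theorem C_mem_reesAlgebra {R : Type*} [CommRing R] {I : Ideal R} (r : R) :
    Polynomial.C r ∈ reesAlgebra I :=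
  (reesAlgebra I).algebraMap_mem r

theorem mem_span_pair_left {R : Type*} [CommRing R] (x y : R) : x ∈ Ideal.span {x, y} :=
  Ideal.subset_span (by simp)

theorem mem_span_pair_right {R : Type*} [CommRing R] (x y : R) : y ∈ Ideal.span {x, y} :=
  Ideal.subset_span (by simp)

/-- Along each of the three planes the determinant is linear in the normal directions, hence
vanishes to order exactly one. An exponent 0 imposes no condition and stays 0, which is what
truncated subtraction gives. -/
theorem det_mul_mem_J_iff (m n : ℕ) (f : PolyABCD) : det * f ∈ J m n ↔ f ∈ J (m - 1) (n - 1) := by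
  have hab := det_mul_mem_span_pow_iff (x := X 0) (y := X 1)
    ![.C (X 0) * .X, .C (X 1) * .X, .C (X 2), .C (X 3)]
    (by intro s; fin_cases s <;> simp)
    (by
      intro s
      fin_cases s
      exacts [C_mul_X_mem_reesAlgebra (mem_span_pair_left _ _),
        C_mul_X_mem_reesAlgebra (mem_span_pair_right _ _), C_mem_reesAlgebra _,
        C_mem_reesAlgebra _])
    (by simp) (by simp) (by simp [det]; ring) m f
  have hcd := det_mul_mem_span_pow_iff (x := X 2) (y := X 3)
    ![.C (X 0), .C (X 1), .C (X 2) * .X, .C (X 3) * .X]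
    (by intro s; fin_cases s <;> simp)
    (by
      intro s
      fin_cases s
      exacts [C_mem_reesAlgebra _, C_mem_reesAlgebra _,
        C_mul_X_mem_reesAlgebra (mem_span_pair_left _ _),
        C_mul_X_mem_reesAlgebra (mem_span_pair_right _ _)])
    (by simp) (by simp) (by simp [det]; ring) n f
  -- The point (a, b) moves on a line towards (c, d), which scales a - c and b - d by the parameter.
  -- The determinant scales too, being equal to (a-c)d - (b-d)c.
  have hdiff := det_mul_mem_span_pow_iff (x := X 0 - X 2) (y := X 1 - X 3)
    ![.C (X 2) + .C (X 0 - X 2) * .X, .C (X 3) + .C (X 1 - X 3) * .X, .C (X 2), .C (X 3)]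
    (by intro s; fin_cases s <;> simp)
    (by
      intro s
      fin_cases s
      exacts [add_mem (C_mem_reesAlgebra _) (C_mul_X_mem_reesAlgebra (mem_span_pair_left _ _)),
        add_mem (C_mem_reesAlgebra _) (C_mul_X_mem_reesAlgebra (mem_span_pair_right _ _)),
        C_mem_reesAlgebra _, C_mem_reesAlgebra _])
    (by simp) (by simp) (by simp [det]; ring) m f
  simp only [J, Ideal.mem_inf, hab, hcd, hdiff]

/-! ### Restriction to the diagonal -/

/-- Bihomogeneous polynomials in `a, b, c, d`. -/
abbrev Bihom (f : PolyABCD) (i j : ℕ) : Prop := IsWeightedHomogeneous weightABCD f (i, j)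

theorem bihom_a : Bihom (X 0) 1 0 := isWeightedHomogeneous_X _ _ _
theorem bihom_b : Bihom (X 1) 0 1 := isWeightedHomogeneous_X _ _ _
theorem bihom_c : Bihom (X 2) 1 0 := isWeightedHomogeneous_X _ _ _
theorem bihom_d : Bihom (X 3) 0 1 := isWeightedHomogeneous_X _ _ _

theorem bihom_det : Bihom det 1 1 :=
  (bihom_a.mul bihom_d).sub (bihom_b.mul bihom_c)

theorem bihom_induction {i j : ℕ} {P : PolyABCD → Prop} (zero : P 0)
    (add : ∀ f g, P f → P g → P (f + g))
    (monomial : ∀ (r : ℂ) (α β γ δ : ℕ), α + γ = i → β + δ = j →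
      P (C r * (X 0 ^ α * X 1 ^ β * X 2 ^ γ * X 3 ^ δ)))
    {f : PolyABCD} (hf : Bihom f i j) : P f := by
  refine IsWeightedHomogeneous.induction_on (motive := fun p _ => P p) zero
    (fun p q _ _ => add p q) ?_ hf
  intro e r he
  rw [monomial_eq, Finsupp.prod_fintype _ _ (by simp), Fin.prod_univ_four]
  rw [Finsupp.weight_apply, Finsupp.sum_fintype _ _ (by simp), Fin.sum_univ_four] at he
  simp [weightABCD] at he
  exact monomial r _ _ _ _ he.1 he.2

/-- Restriction to the diagonal `(a, c) = (b, d)`, in the coordinate `z = a / c`. -/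
def diag : PolyABCD →ₐ[ℂ] Polynomial ℂ := aeval ![.X, .X, 1, 1]

@[simp] theorem diag_a : diag (X 0) = .X := by simp [diag]
@[simp] theorem diag_b : diag (X 1) = .X := by simp [diag]
@[simp] theorem diag_c : diag (X 2) = 1 := by simp [diag]
@[simp] theorem diag_d : diag (X 3) = 1 := by simp [diag]

@[simp] theorem diag_det : diag det = 0 := by simp [det]

/-- Restriction to the diagonal in the coordinate `c / a`. -/
def diagInv : PolyABCD →ₐ[ℂ] Polynomial ℂ := aeval ![1, 1, .X, .X]

/-- Each monomial has total degree i + j, so exchanging the roles of (a, b) and (c, d) reverses the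
coefficients of the restriction. -/
theorem natDegree_diag_le_and_reflect {i j : ℕ} {f : PolyABCD} (hf : Bihom f i j) :
    (diag f).natDegree ≤ i + j ∧ (diag f).reflect (i + j) = diagInv f := by
  refine bihom_induction (P := fun f => (diag f).natDegree ≤ i + j ∧
    (diag f).reflect (i + j) = diagInv f) ?_ ?_ ?_ hf
  · simp
  · rintro f g ⟨hf, hf'⟩ ⟨hg, hg'⟩
    rw [map_add, map_add, Polynomial.reflect_add, hf', hg']
    exact ⟨Polynomial.natDegree_add_le_of_degree_le hf hg, rfl⟩
  · intro r α β γ δ hi hj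
    have h1 : diag (C r * (X 0 ^ α * X 1 ^ β * X 2 ^ γ * X 3 ^ δ)) = .C r * .X ^ (α + β) := by
      simp [pow_add]
    have h2 : diagInv (C r * (X 0 ^ α * X 1 ^ β * X 2 ^ γ * X 3 ^ δ)) = .C r * .X ^ (γ + δ) := by
      simp [pow_add, diagInv]
    rw [h1, h2, Polynomial.reflect_C_mul_X_pow, Polynomial.revAt_le (by omega)]
    refine ⟨(Polynomial.natDegree_C_mul_X_pow_le _ _).trans (by omega), ?_⟩
    congr 2
    omega

theorem pow_dvd_of_mem_span_pow {A : Type*} [CommRing A] [Algebra ℂ A] (φ : PolyABCD →ₐ[ℂ] A)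
    {x y f : PolyABCD} {z : A} {n : ℕ} (hx : z ∣ φ x) (hy : z ∣ φ y)
    (hf : f ∈ Ideal.span {x, y} ^ n) : z ^ n ∣ φ f := by
  have hle : (Ideal.span {x, y}).map φ ≤ Ideal.span {z} := by
    rw [Ideal.map_le_iff_le_comap, Ideal.span_le]
    rintro w (rfl | rfl)
    exacts [Ideal.mem_span_singleton.2 hx, Ideal.mem_span_singleton.2 hy]
  rw [← Ideal.mem_span_singleton, ← Ideal.span_singleton_pow]
  apply Ideal.pow_right_mono hle n
  rw [← Ideal.map_pow]
  exact Ideal.mem_map_of_mem φ hf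

/-- Vanishing along c = d = 0 becomes vanishing at z = ∞, that is, a drop in degree. -/
theorem diag_mem_degreeLT {i j n : ℕ} {f : PolyABCD} (hf : Bihom f i j)
    (hn : f ∈ Ideal.span {X 2, X 3} ^ n) :
    diag f ∈ Polynomial.degreeLT ℂ (i + j + 1 - n) := by
  obtain ⟨h1, h2⟩ := natDegree_diag_le_and_reflect hf
  have h3 : Polynomial.X ^ n ∣ diagInv f :=
    pow_dvd_of_mem_span_pow diagInv (by simp [diagInv]) (by simp [diagInv]) hn
  rw [← h2, Polynomial.X_pow_dvd_iff] at h3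
  rw [Polynomial.mem_degreeLT, Polynomial.degree_lt_iff_coeff_zero]
  intro k hk
  rcases lt_or_ge (i + j) k with hk' | hk'
  · exact Polynomial.coeff_eq_zero_of_natDegree_lt (by omega)
  · have := h3 (i + j - k) (by omega)
    rwa [Polynomial.coeff_reflect, Polynomial.revAt_le (by omega), Nat.sub_sub_self hk'] at this

/-- The polynomial `zᵐ (z - 1)ᵐ`. -/
def diagFactor (m : ℕ) : Polynomial ℂ := .X ^ m * (.X - 1) ^ m

theorem diagFactor_monic (m : ℕ) : (diagFactor m).Monic := by
  have := Polynomial.monic_X_sub_C (1 : ℂ)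
  rw [Polynomial.C_1] at this
  exact (Polynomial.monic_X_pow m).mul (this.pow m)

theorem natDegree_diagFactor (m : ℕ) : (diagFactor m).natDegree = 2 * m := by
  have := Polynomial.monic_X_sub_C (1 : ℂ)
  have h2 := Polynomial.natDegree_X_sub_C (1 : ℂ)
  rw [Polynomial.C_1] at this h2
  rw [diagFactor, (Polynomial.monic_X_pow m).natDegree_mul (this.pow m), this.natDegree_pow, h2]
  simp
  ring

/-- The ideals (a,b), (a-c,b-d) and (c,d) force zeros at 0, 1 and ∞ respectively. The first two
combine because z and z - 1 are coprime. -/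
theorem exists_diag_eq {i j m n : ℕ} {f : PolyABCD} (hf : f ∈ part weightABCD (J m n) (i, j)) :
    ∃ h ∈ Polynomial.degreeLT ℂ (i + j + 1 - (2 * m + n)), diag f = diagFactor m * h := by
  obtain ⟨⟨⟨hab, hcd⟩, hdiff⟩, hom⟩ := hf
  have h1 : Polynomial.X ^ m ∣ diag f := pow_dvd_of_mem_span_pow diag (by simp) (by simp) hab
  have h2 : (Polynomial.X - 1) ^ m ∣ diag f :=
    pow_dvd_of_mem_span_pow diag (by simp) (by simp) hdiff
  have hcop : IsCoprime (Polynomial.X ^ m : Polynomial ℂ) ((Polynomial.X - 1) ^ m) :=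
    IsCoprime.pow ⟨1, -1, by ring⟩
  obtain ⟨h, hh⟩ := hcop.mul_dvd h1 h2
  refine ⟨h, ?_, hh⟩
  have hlt := diag_mem_degreeLT hom hcd
  by_cases h0 : h = 0
  · rw [h0]; exact zero_mem _
  have hh' : diag f = diagFactor m * h := hh
  rw [hh', Polynomial.mem_degreeLT, Polynomial.degree_mul, Polynomial.degree_eq_natDegree h0,
    Polynomial.degree_eq_natDegree (diagFactor_monic m).ne_zero, natDegree_diagFactor] at hlt
  rw [Polynomial.mem_degreeLT, Polynomial.degree_eq_natDegree h0]
  norm_cast at hlt ⊢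
  omega

/-- The binary form zᵅ(z-1)ᵝ1ᵞ has i + j linear factors. Lift i of them to a, a - c, c and the other
j to b, b - d, d. -/
theorem exists_polarization {i j α β γ : ℕ} (h : α + β + γ = i + j) :
    ∃ y, Bihom y i j ∧ y ∈ Ideal.span {X 0, X 1} ^ α ∧ y ∈ Ideal.span {X 2, X 3} ^ γ ∧
      y ∈ Ideal.span {X 0 - X 2, X 1 - X 3} ^ β ∧ diag y = .X ^ α * (.X - 1) ^ β := by
  obtain ⟨α₁, α₂, β₁, β₂, γ₁, γ₂, rfl, rfl, rfl, rfl, rfl⟩ : ∃ α₁ α₂ β₁ β₂ γ₁ γ₂ : ℕ,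
      α = α₁ + α₂ ∧ β = β₁ + β₂ ∧ γ = γ₁ + γ₂ ∧ i = α₁ + β₁ + γ₁ ∧ j = α₂ + β₂ + γ₂ :=
    -- A greedy choice: the i factors of the first kind are taken from the z's, then from the
    -- (z-1)'s, then from the 1's.
    ⟨min α i, α - min α i, min β (i - min α i), β - min β (i - min α i),
      i - min α i - min β (i - min α i), γ - (i - min α i - min β (i - min α i)),
      by omega, by omega, by omega, by omega, by omega⟩
  have key : ∀ (x y : PolyABCD) (k l : ℕ), x ^ k * y ^ l ∈ Ideal.span {x, y} ^ (k + l) :=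
    fun x y k l => by
      rw [pow_add]
      exact Ideal.mul_mem_mul (Ideal.pow_mem_pow (mem_span_pair_left _ _) _)
        (Ideal.pow_mem_pow (mem_span_pair_right _ _) _)
  refine ⟨(X 0 ^ α₁ * X 1 ^ α₂) * ((X 0 - X 2) ^ β₁ * (X 1 - X 3) ^ β₂) * (X 2 ^ γ₁ * X 3 ^ γ₂),
    ?_, ?_, ?_, ?_, ?_⟩
  · have := (((bihom_a.pow α₁).mul (bihom_b.pow α₂)).mul
      (((bihom_a.sub bihom_c).pow β₁).mul ((bihom_b.sub bihom_d).pow β₂))).mul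
      ((bihom_c.pow γ₁).mul (bihom_d.pow γ₂))
    simpa using this
  · rw [mul_assoc]; exact Ideal.mul_mem_right _ _ (key _ _ _ _)
  · exact Ideal.mul_mem_left _ _ (key _ _ _ _)
  · exact Ideal.mul_mem_right _ _ (Ideal.mul_mem_left _ _ (key _ _ _ _))
  · simp [pow_add]

theorem degreeLT_le_of_X_pow {r : ℕ} {M : Submodule ℂ (Polynomial ℂ)}
    (h : ∀ e < r, Polynomial.X ^ e ∈ M) : Polynomial.degreeLT ℂ r ≤ M := by
  classical
  rw [Polynomial.degreeLT_eq_span_X_pow, Submodule.span_le]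
  intro p hp
  obtain ⟨e, he, rfl⟩ := Finset.mem_image.1 (Finset.mem_coe.1 hp)
  exact h e (Finset.mem_range.1 he)

theorem exists_mem_part_diag_eq {i j m n : ℕ} {h : Polynomial ℂ}
    (hh : h ∈ Polynomial.degreeLT ℂ (i + j + 1 - (2 * m + n))) :
    ∃ y ∈ part weightABCD (J m n) (i, j), diag y = diagFactor m * h := by
  have hle : Polynomial.degreeLT ℂ (i + j + 1 - (2 * m + n)) ≤
      ((part weightABCD (J m n) (i, j)).map diag.toLinearMap).comap
        (LinearMap.mulLeft ℂ (diagFactor m)) := by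
    apply degreeLT_le_of_X_pow
    intro e he
    -- The extra zᵉ is absorbed in α. The bound on e is exactly what leaves γ ≥ n.
    obtain ⟨y, h1, h2, h3, h4, h5⟩ := exists_polarization (i := i) (j := j) (α := m + e) (β := m)
      (γ := i + j - (2 * m + e)) (by omega)
    refine ⟨y, ⟨⟨⟨Ideal.pow_le_pow_right (by omega) h2, Ideal.pow_le_pow_right (by omega) h3⟩, h4⟩,
      h1⟩, ?_⟩
    simp only [AlgHom.toLinearMap_apply, h5, LinearMap.mulLeft_apply, diagFactor]
    ring
  exact hle hh

theorem map_diag_part (i j m n : ℕ) :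
    (part weightABCD (J m n) (i, j)).map diag.toLinearMap =
      (Polynomial.degreeLT ℂ (i + j + 1 - (2 * m + n))).map
        (LinearMap.mulLeft ℂ (diagFactor m)) := by
  apply le_antisymm
  · rintro _ ⟨f, hf, rfl⟩
    obtain ⟨h, hh, e⟩ := exists_diag_eq hf
    exact ⟨h, hh, e.symm⟩
  · rintro _ ⟨h, hh, rfl⟩
    obtain ⟨y, hy, e⟩ := exists_mem_part_diag_eq hh
    exact ⟨y, hy, e⟩

/-! ### The kernel of the restriction -/

/-- The polynomial `∑ pₖ bᵏ dᴺ⁻ᵏ` attached to `p = ∑ pₖ zᵏ`. -/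
def homogenize (N : ℕ) (p : Polynomial ℂ) : PolyABCD :=
  p.sum fun k r => C r * (X 1 ^ k * X 3 ^ (N - k))

/-- Modulo the determinant ad = bc, so multiplying by dⁱ turns every a into b at the cost of a
factor c. The result depends on the restriction of f only. -/
theorem det_dvd_d_pow_mul_sub {i j : ℕ} {f : PolyABCD} (hf : Bihom f i j) :
    det ∣ X 3 ^ i * f - X 2 ^ i * homogenize (i + j) (diag f) := by
  have hadd : ∀ p p' : Polynomial ℂ, homogenize (i + j) (p + p') =
      homogenize (i + j) p + homogenize (i + j) p' := fun p p' =>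
    Polynomial.sum_add_index _ _ _ (by simp) (by intros; simp [add_mul])
  refine bihom_induction (P := fun f => det ∣ X 3 ^ i * f - X 2 ^ i * homogenize (i + j) (diag f))
    ?_ ?_ ?_ hf
  · simp [homogenize]
  · intro f g hf hg
    rw [map_add, hadd]
    convert! dvd_add hf hg using 1
    ring
  · intro r α β γ δ hi hj
    have h1 : diag (C r * (X 0 ^ α * X 1 ^ β * X 2 ^ γ * X 3 ^ δ)) = .monomial (α + β) r := by
      rw [← Polynomial.C_mul_X_pow_eq_monomial]
      simp [pow_add]
    rw [h1, homogenize, Polynomial.sum_monomial_index _ _ (by simp),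
      show i + j - (α + β) = γ + δ by omega, ← hi]
    have h2 := sub_dvd_pow_sub_pow (X 0 * X 3 : PolyABCD) (X 1 * X 2) α
    rw [← det] at h2
    convert! h2.mul_left (C r * X 1 ^ β * X 2 ^ γ * X 3 ^ (γ + δ)) using 1
    ring

theorem det_dvd_of_diag_eq_zero {i j : ℕ} {f : PolyABCD} (hf : Bihom f i j) (h0 : diag f = 0) :
    det ∣ f := by
  have h := det_dvd_d_pow_mul_sub hf
  rw [h0] at h
  simp only [homogenize, Polynomial.sum_zero_index, mul_zero, sub_zero] at h
  obtain ⟨g, hg⟩ := h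
  -- The prime d does not divide the determinant, so the power of d can be cancelled.
  have hd : ¬ (X 3 : PolyABCD) ∣ det := by
    rintro ⟨g, hg⟩
    have := congrArg (MvPolynomial.eval ![0, 1, 1, 0]) hg
    simp [det] at this
  obtain ⟨k, rfl⟩ := (X_prime (R := ℂ) (i := (3 : Fin 4))).pow_dvd_of_dvd_mul_left i hd ⟨f, hg.symm⟩
  refine ⟨k, mul_left_cancel₀ (pow_ne_zero i (X_ne_zero (3 : Fin 4))) (hg.trans ?_)⟩
  ring

theorem eq_det_mul_of_diag_eq_zero {m n : ℕ} {p : ℕ × ℕ} {f : PolyABCD}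
    (hf : f ∈ part weightABCD (J m n) p) (h0 : diag f = 0) :
    f = 0 ∨ (1, 1) ≤ p ∧ ∃ g ∈ part weightABCD (J (m - 1) (n - 1)) (p - (1, 1)), f = det * g := by
  obtain ⟨g, rfl⟩ := det_dvd_of_diag_eq_zero (i := p.1) (j := p.2) hf.2 h0
  rcases isWeightedHomogeneous_of_mul_left bihom_det det_ne_zero hf.2 with h | ⟨h, hg⟩
  · left; rw [h, mul_zero]
  · exact Or.inr ⟨h, g, ⟨(det_mul_mem_J_iff m n g).1 hf.1, hg⟩, rfl⟩

theorem det_mul_mem_part {m n : ℕ} {p : ℕ × ℕ} (hp : (1, 1) ≤ p) {g : PolyABCD}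
    (hg : g ∈ part weightABCD (J (m - 1) (n - 1)) (p - (1, 1))) :
    det * g ∈ part weightABCD (J m n) p := by
  refine ⟨(det_mul_mem_J_iff m n g).2 hg.1, ?_⟩
  have := bihom_det.mul hg.2
  rwa [add_tsub_cancel_of_le hp] at this

/-! ### Dimensions of the bigraded pieces of J -/

theorem finrank_map_diag_part (m n : ℕ) (p : ℕ × ℕ) :
    FiniteDimensional ℂ ((part weightABCD (J m n) p).map diag.toLinearMap) ∧
    Module.finrank ℂ ((part weightABCD (J m n) p).map diag.toLinearMap) =
      p.1 + p.2 + 1 - (2 * m + n) := by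
  have hinj : Function.Injective (LinearMap.mulLeft ℂ (diagFactor m)) :=
    fun _ _ h => mul_left_cancel₀ (diagFactor_monic m).ne_zero h
  let e := (Polynomial.degreeLTEquiv ℂ (p.1 + p.2 + 1 - (2 * m + n))).symm.trans
    (Submodule.equivMapOfInjective _ hinj _)
  rw [map_diag_part]
  exact ⟨e.finiteDimensional, by rw [← e.finrank_eq, Module.finrank_fin_fun]⟩

theorem finiteDimensional_and_finrank_part_J_of_le {m n : ℕ} {p : ℕ × ℕ} (hp : (1, 1) ≤ p)
    (hfin : FiniteDimensional ℂ (part weightABCD (J (m - 1) (n - 1)) (p - (1, 1)))) :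
    FiniteDimensional ℂ (part weightABCD (J m n) p) ∧
    Module.finrank ℂ (part weightABCD (J m n) p) = (p.1 + p.2 + 1 - (2 * m + n)) +
      Module.finrank ℂ (part weightABCD (J (m - 1) (n - 1)) (p - (1, 1))) := by
  obtain ⟨h1, h2⟩ := finrank_map_diag_part m n p
  rw [← h2]
  apply finrank_of_ker_eq_map _ diag.toLinearMap (LinearMap.mulLeft ℂ det)
    (fun _ _ h => mul_left_cancel₀ det_ne_zero h)
  apply le_antisymm
  · rintro f ⟨hf, h0⟩
    rcases eq_det_mul_of_diag_eq_zero hf h0 with rfl | ⟨-, g, hg, rfl⟩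
    exacts [zero_mem _, ⟨g, hg, rfl⟩]
  · rintro _ ⟨g, hg, rfl⟩
    exact ⟨det_mul_mem_part hp hg, by simp⟩

theorem finiteDimensional_and_finrank_part_J_of_not_le {m n : ℕ} {p : ℕ × ℕ} (hp : ¬ (1, 1) ≤ p) :
    FiniteDimensional ℂ (part weightABCD (J m n) p) ∧
    Module.finrank ℂ (part weightABCD (J m n) p) = p.1 + p.2 + 1 - (2 * m + n) := by
  obtain ⟨h1, h2⟩ := finrank_map_diag_part m n p
  rw [← h2, ← add_zero (Module.finrank ℂ (Submodule.map _ _)),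
    ← finrank_bot ℂ (MvPolynomial (Fin 4) ℂ)]
  apply finrank_of_ker_eq_map _ diag.toLinearMap LinearMap.id Function.injective_id
  rw [Submodule.map_bot, eq_bot_iff]
  rintro f ⟨hf, h0⟩
  exact (eq_det_mul_of_diag_eq_zero hf h0).resolve_right fun h => hp h.1

/-- Needed before dimensions can be added, as `Module.finrank` is 0 on infinite-dimensional spaces.
Each division by the determinant lowers i, which gives the induction. -/
theorem finiteDimensional_part_J (m n : ℕ) (p : ℕ × ℕ) :
    FiniteDimensional ℂ (part weightABCD (J m n) p) := by
  obtain ⟨i, j⟩ := p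
  induction i generalizing j m n with
  | zero => exact (finiteDimensional_and_finrank_part_J_of_not_le (by simp)).1
  | succ i ih =>
    by_cases hp : (1, 1) ≤ (i + 1, j)
    · exact (finiteDimensional_and_finrank_part_J_of_le hp (ih _ _ _)).1
    · exact (finiteDimensional_and_finrank_part_J_of_not_le hp).1

theorem finrank_part_J (m n : ℕ) (p : ℕ × ℕ) :
    Module.finrank ℂ (part weightABCD (J m n) p) = (p.1 + p.2 + 1 - (2 * m + n)) +
      if (1, 1) ≤ p then Module.finrank ℂ (part weightABCD (J (m - 1) (n - 1)) (p - (1, 1)))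
      else 0 := by
  split_ifs with hp
  · exact (finiteDimensional_and_finrank_part_J_of_le hp (finiteDimensional_part_J _ _ _)).2
  · exact (finiteDimensional_and_finrank_part_J_of_not_le hp).2

/-! ### Generators of the ideals `J` -/

theorem isBihomogeneous_J (m n : ℕ) : IsBihomogeneous weightABCD (J m n) :=
  (((isBihomogeneous_span_pair bihom_a bihom_b).pow m).inf
    ((isBihomogeneous_span_pair bihom_c bihom_d).pow n)).inf
    ((isBihomogeneous_span_pair (bihom_a.sub bihom_c) (bihom_b.sub bihom_d)).pow m)

/-- Below total degree 2m + n the restriction is zero, so the determinant divides. Dividing by it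
lowers the degree by 2 but the threshold by 3, so each further unit below the threshold yields
another factor. The bounds k ≤ m ≤ n keep the exponents from being truncated. -/
theorem det_pow_dvd_of_mem_part {k m n : ℕ} {p : ℕ × ℕ} (hmn : m ≤ n) (hk : k ≤ m)
    (hp : p.1 + p.2 + k < 2 * m + n) {f : PolyABCD} (hf : f ∈ part weightABCD (J m n) p) :
    det ^ (k + 1) ∣ f := by
  induction k generalizing m n p f with
  | zero =>
    obtain ⟨h, hh, e⟩ := exists_diag_eq (i := p.1) (j := p.2) hf
    rw [Nat.sub_eq_zero_of_le (by omega), Polynomial.mem_degreeLT, Nat.cast_zero,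
      Nat.WithBot.lt_zero_iff, Polynomial.degree_eq_bot] at hh
    rw [hh, mul_zero] at e
    rw [zero_add, pow_one]
    exact det_dvd_of_diag_eq_zero hf.2 e
  | succ k ih =>
    have hdvd := ih hmn (by omega) (by omega) hf
    have h0 : diag f = 0 := by
      obtain ⟨g, rfl⟩ := hdvd
      simp
    rcases eq_det_mul_of_diag_eq_zero hf h0 with rfl | ⟨hle, g, hg, rfl⟩
    · exact dvd_zero _
    · rw [pow_succ']
      have h1 : 1 ≤ p.1 := hle.1
      have h2 : 1 ≤ p.2 := hle.2
      refine mul_dvd_mul_left _ (ih (by omega) (by omega) ?_ hg)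
      simp only [Prod.fst_sub, Prod.snd_sub]
      omega

/-- A component of 𝔪J comes from components of J of total degree one less, which gains one factor of
the determinant over what J itself satisfies in this degree. This is what certifies that a generator
is not in 𝔪J. -/
theorem det_pow_dvd_component {m n : ℕ} (hmn : m ≤ n) {f : PolyABCD} (hf : f ∈ maxMul (J m n))
    {k : ℕ} {p : ℕ × ℕ} (hk : k ≤ m) (hp : p.1 + p.2 + k = 2 * m + n) :
    det ^ (k + 1) ∣ weightedHomogeneousComponent weightABCD p f := by
  rw [mem_maxMul] at hf
  induction hf using Submodule.mul_induction_on' with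
  | mem_mul_mem x hx y hy =>
    induction hx using Submodule.span_induction generalizing y with
    | mem x hx =>
      obtain ⟨s, rfl⟩ := hx
      rw [weightedHomogeneousComponent_mul (isWeightedHomogeneous_X ℂ weightABCD s)]
      split_ifs with hle
      · refine (det_pow_dvd_of_mem_part (p := p - weightABCD s) hmn hk ?_
          ⟨(isBihomogeneous_J m n).component_mem hy _,
            weightedHomogeneousComponent_isWeightedHomogeneous _ _⟩).mul_left _
        have h1 := hle.1
        have h2 := hle.2
        have h3 : (weightABCD s).1 + (weightABCD s).2 = 1 := by fin_cases s <;> rfl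
        simp only [Prod.fst_sub, Prod.snd_sub]
        omega
      · exact dvd_zero _
    | zero => simp
    | add x x' _ _ h h' => rw [add_mul, map_add]; exact dvd_add (h y hy) (h' y hy)
    | smul c x _ h =>
      rw [smul_eq_mul, mul_comm c, mul_assoc]
      exact h _ (Ideal.mul_mem_left _ _ hy)
  | add x _ y _ h h' => rw [map_add]; exact dvd_add h h'

theorem X_mul_mem_maxMul {m n : ℕ} (s : Fin 4) {f : PolyABCD} (hf : f ∈ J m n) :
    X s * f ∈ maxMul (J m n) :=
  Ideal.mul_mem_mul (X_mem_maxIdeal s) hf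

/-- Above total degree 2m + n, every restriction is already attained by a variable times an element
of J of degree one less. -/
theorem exists_mem_maxMul_diag_eq {i j m n : ℕ} (hij : 2 * m + n < i + j) {h : Polynomial ℂ}
    (hh : h ∈ Polynomial.degreeLT ℂ (i + j + 1 - (2 * m + n))) :
    ∃ y ∈ part weightABCD (J m n) (i, j) ⊓ maxMul (J m n), diag y = diagFactor m * h := by
  have hle : Polynomial.degreeLT ℂ (i + j + 1 - (2 * m + n)) ≤
      ((part weightABCD (J m n) (i, j) ⊓ maxMul (J m n)).map diag.toLinearMap).comap
        (LinearMap.mulLeft ℂ (diagFactor m)) := by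
    apply degreeLT_le_of_X_pow
    intro e he
    have key : ∀ (s : Fin 4) (k i' j' : ℕ), weightABCD s + (i', j') = (i, j) →
        k < i' + j' + 1 - (2 * m + n) → diag (X s) * .X ^ k = .X ^ e →
        LinearMap.mulLeft ℂ (diagFactor m) (.X ^ e) ∈
          (part weightABCD (J m n) (i, j) ⊓ maxMul (J m n)).map diag.toLinearMap := by
      intro s k i' j' hw hk hs
      obtain ⟨y, hy, hdiag⟩ := exists_mem_part_diag_eq (i := i') (j := j') (m := m) (n := n)
        (h := .X ^ k) (by
          rw [Polynomial.mem_degreeLT, Polynomial.degree_X_pow]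
          exact_mod_cast hk)
      refine ⟨X s * y, ⟨⟨Ideal.mul_mem_left _ _ hy.1, ?_⟩, X_mul_mem_maxMul s hy.1⟩, ?_⟩
      · have := (isWeightedHomogeneous_X ℂ weightABCD s).mul hy.2
        rwa [hw] at this
      · simp only [AlgHom.toLinearMap_apply, LinearMap.mulLeft_apply, map_mul, hdiag, ← hs]
        ring
    -- The variable multiplied in is a or c when i > 0, and b or d otherwise. Of these, c and d
    -- restrict to 1 and serve e = 0, while a and b restrict to z and serve e > 0.
    rcases i with _ | i
    · rcases j with _ | j
      · omega
      rcases e with _ | e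
      · exact key 3 0 0 j (by simp [weightABCD, add_comm]) (by omega) (by simp)
      · exact key 1 e 0 j (by simp [weightABCD, add_comm]) (by omega) (by simp [pow_succ'])
    · rcases e with _ | e
      · exact key 2 0 i j (by simp [weightABCD, add_comm]) (by omega) (by simp)
      · exact key 0 e i j (by simp [weightABCD, add_comm]) (by omega) (by simp [pow_succ'])
  exact hle hh

theorem det_mul_mem_maxMul {m n : ℕ} {f : PolyABCD} (hf : f ∈ maxMul (J m n)) :
    det * f ∈ maxMul (J (m + 1) (n + 1)) := by
  rw [mem_maxMul] at hf ⊢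
  induction hf using Submodule.mul_induction_on' with
  | mem_mul_mem x hx y hy =>
    rw [mul_left_comm]
    exact Ideal.mul_mem_mul hx ((det_mul_mem_J_iff _ _ _).2 hy)
  | add x _ y _ h h' => rw [mul_add]; exact add_mem h h'

/-- For m = 0 the ideal is (c,d)ⁿ, and ad - bc multiplies elements of (c,d) by variables. So the
determinant produces no generator once the first exponent is exhausted, whence the bound k ≤ m in
`IsGeneratorDegree`. -/
theorem det_mul_mem_maxMul_zero {n : ℕ} {f : PolyABCD} (hf : f ∈ J 0 (n - 1)) :
    det * f ∈ maxMul (J 0 n) := by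
  have hJ : ∀ n, J 0 n = Ideal.span {X 2, X 3} ^ n := fun n => by simp [J]
  have key : ∀ x ∈ Ideal.span {(X 2 : PolyABCD), X 3}, x * f ∈ J 0 n := fun x hx => by
    rw [hJ] at hf ⊢
    rcases n with _ | n
    · simp
    · rw [pow_succ']
      exact Ideal.mul_mem_mul hx hf
  have : det * f = X 0 * (X 3 * f) - X 1 * (X 2 * f) := by rw [det]; ring
  rw [this]
  exact sub_mem (X_mul_mem_maxMul 0 (key _ (mem_span_pair_right _ _)))
    (X_mul_mem_maxMul 1 (key _ (mem_span_pair_left _ _)))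

/-- `J(m, n)` has a minimal generator in bidegree `p`. -/
def IsGeneratorDegree (m n : ℕ) (p : ℕ × ℕ) : Prop :=
  ∃ k, k ≤ m ∧ (k, k) ≤ p ∧ p.1 + p.2 + k = 2 * m + n

/-- The restriction of y is zero below total degree 2m + n and is attained by 𝔪J above it. In both
cases y is congruent modulo 𝔪J to an element of the kernel. -/
theorem exists_maxMul_add_det_mul {m n : ℕ} {p : ℕ × ℕ} (hp : p.1 + p.2 ≠ 2 * m + n) {y : PolyABCD}
    (hy : y ∈ part weightABCD (J m n) p) : ∃ y₀ ∈ maxMul (J m n), y = y₀ ∨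
      (1, 1) ≤ p ∧ ∃ g ∈ part weightABCD (J (m - 1) (n - 1)) (p - (1, 1)), y = y₀ + det * g := by
  obtain ⟨h, hh, e⟩ := exists_diag_eq (i := p.1) (j := p.2) hy
  obtain ⟨y₀, hy₀, e₀⟩ : ∃ y₀ ∈ part weightABCD (J m n) p ⊓ maxMul (J m n),
      diag y₀ = diagFactor m * h := by
    rcases lt_or_gt_of_ne hp with hlt | hlt
    · rw [Nat.sub_eq_zero_of_le (by omega), Polynomial.mem_degreeLT, Nat.cast_zero,
        Nat.WithBot.lt_zero_iff, Polynomial.degree_eq_bot] at hh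
      exact ⟨0, zero_mem _, by simp [hh]⟩
    · exact exists_mem_maxMul_diag_eq hlt hh
  refine ⟨y₀, hy₀.2, ?_⟩
  rcases eq_det_mul_of_diag_eq_zero (sub_mem hy hy₀.1) (by rw [map_sub, e, e₀, sub_self]) with
    h | ⟨hle, g, hg, h⟩
  · exact Or.inl (sub_eq_zero.1 h)
  · exact Or.inr ⟨hle, g, hg, by rw [← h]; ring⟩

theorem part_le_maxMul {m n : ℕ} (hmn : m ≤ n) {p : ℕ × ℕ} (hp : ¬ IsGeneratorDegree m n p) :
    part weightABCD (J m n) p ≤ maxMul (J m n) := by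
  intro y hy
  induction m generalizing n p y with
  | zero =>
    obtain ⟨y₀, h₀, rfl | ⟨-, g, hg, rfl⟩⟩ := exists_maxMul_add_det_mul
      (fun h => hp ⟨0, le_rfl, Prod.mk_le_mk.2 ⟨Nat.zero_le _, Nat.zero_le _⟩, h⟩) hy
    · exact h₀
    · exact add_mem h₀ (det_mul_mem_maxMul_zero hg.1)
  | succ m ih =>
    obtain ⟨n, rfl⟩ : ∃ n', n = n' + 1 := ⟨n - 1, by omega⟩
    obtain ⟨y₀, h₀, rfl | ⟨hle, g, hg, rfl⟩⟩ := exists_maxMul_add_det_mul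
      (fun h => hp ⟨0, Nat.zero_le _, Prod.mk_le_mk.2 ⟨Nat.zero_le _, Nat.zero_le _⟩, h⟩) hy
    · exact h₀
    · refine add_mem h₀ (det_mul_mem_maxMul (ih (by omega) ?_ hg))
      rintro ⟨k, hk, hkp, hs⟩
      refine hp ⟨k + 1, by omega, ?_⟩
      simp only [Prod.le_def, Prod.fst_sub, Prod.snd_sub] at hle hkp hs ⊢
      omega

/-- After division by the k-th power of the determinant, the bidegree lies at the threshold for
J(m-k, n-k), where the space of restrictions is a line. The element `w` lifts a basis of that line.
-/
theorem exists_generator_aux {k m n : ℕ} (hmn : m ≤ n) {p : ℕ × ℕ} (hk : k ≤ m) (hkp : (k, k) ≤ p)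
    (hp : p.1 + p.2 + k = 2 * m + n) : ∃ w : PolyABCD, diag w ≠ 0 ∧
      det ^ k * w ∈ part weightABCD (J m n) p ∧
      ∀ y ∈ part weightABCD (J m n) p, ∃ c : ℂ, y - c • (det ^ k * w) ∈ maxMul (J m n) := by
  induction k generalizing m n p with
  | zero =>
    have hr : p.1 + p.2 + 1 - (2 * m + n) = 1 := by omega
    obtain ⟨w, hw, e⟩ := exists_mem_part_diag_eq (i := p.1) (j := p.2) (m := m) (n := n) (h := 1)
      (by rw [hr, Polynomial.mem_degreeLT]; simp)
    refine ⟨w, by rw [e, mul_one]; exact (diagFactor_monic m).ne_zero, by simpa using hw, ?_⟩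
    intro y hy
    obtain ⟨h, hh, e'⟩ := exists_diag_eq (i := p.1) (j := p.2) hy
    rw [hr, Polynomial.mem_degreeLT, Nat.cast_one] at hh
    obtain ⟨c, rfl⟩ : ∃ c, h = Polynomial.C c :=
      ⟨_, Polynomial.eq_C_of_degree_le_zero (Nat.WithBot.lt_one_iff_le_zero.1 hh)⟩
    refine ⟨c, ?_⟩
    rw [pow_zero, one_mul]
    rcases eq_det_mul_of_diag_eq_zero (sub_mem hy (Submodule.smul_mem _ c hw))
      (by rw [map_sub, map_smul, e, e', Polynomial.smul_eq_C_mul]; ring) with h | ⟨hle, g, hg, h⟩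
    · rw [h]; exact zero_mem _
    · rw [h]
      rcases m with _ | m
      · exact det_mul_mem_maxMul_zero hg.1
      · obtain ⟨n, rfl⟩ : ∃ n', n = n' + 1 := ⟨n - 1, by omega⟩
        refine det_mul_mem_maxMul (part_le_maxMul (by omega) ?_ hg)
        -- The total degree of g exceeds by one the largest generator degree of the smaller ideal.
        rintro ⟨k, hk, hkp, hs⟩
        simp only [Prod.le_def, Prod.fst_sub, Prod.snd_sub] at hle hkp hs
        omega
  | succ k ih =>
    obtain ⟨m, rfl⟩ : ∃ m', m = m' + 1 := ⟨m - 1, by omega⟩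
    obtain ⟨n, rfl⟩ : ∃ n', n = n' + 1 := ⟨n - 1, by omega⟩
    have h1 : k + 1 ≤ p.1 := hkp.1
    have h2 : k + 1 ≤ p.2 := hkp.2
    have h11 : (1, 1) ≤ p := Prod.mk_le_mk.2 ⟨by omega, by omega⟩
    obtain ⟨w, hw0, hw, hspan⟩ := ih (m := m) (n := n) (p := p - (1, 1)) (by omega) (by omega)
      ⟨Nat.le_sub_of_add_le h1, Nat.le_sub_of_add_le h2⟩
      (by simp only [Prod.fst_sub, Prod.snd_sub]; omega)
    refine ⟨w, hw0, ?_, ?_⟩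
    · rw [pow_succ', mul_assoc]
      exact det_mul_mem_part h11 hw
    · intro y hy
      have h0 : diag y = 0 := by
        obtain ⟨g, rfl⟩ := det_pow_dvd_of_mem_part (k := 0) hmn (Nat.zero_le _) (by omega) hy
        simp
      rcases eq_det_mul_of_diag_eq_zero hy h0 with rfl | ⟨-, g, hg, rfl⟩
      · exact ⟨0, by simp⟩
      · obtain ⟨c, hc⟩ := hspan g hg
        refine ⟨c, ?_⟩
        rw [pow_succ', mul_assoc, ← mul_smul_comm, ← mul_sub]
        exact det_mul_mem_maxMul hc

open scoped Classical in
theorem finrank_generatingPart_J {m n : ℕ} (hmn : m ≤ n) (p : ℕ × ℕ) :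
    Module.finrank ℂ (generatingPart weightABCD (J m n) p) =
      if IsGeneratorDegree m n p then 1 else 0 := by
  split_ifs with hp
  · obtain ⟨k, hk, hkp, hs⟩ := hp
    obtain ⟨w, hw0, hw, hspan⟩ := exists_generator_aux hmn hk hkp hs
    -- Otherwise the determinant would divide w, contradicting its nonzero restriction.
    have hnot : det ^ k * w ∉ maxMul (J m n) := by
      intro hmem
      have h := det_pow_dvd_component hmn hmem hk hs
      rw [IsWeightedHomogeneous.weightedHomogeneousComponent_same hw.2, pow_succ,
        mul_dvd_mul_iff_left (pow_ne_zero k det_ne_zero)] at h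
      obtain ⟨g, rfl⟩ := h
      exact hw0 (by simp)
    have hmap : generatingPart weightABCD (J m n) p =
        Submodule.span ℂ {(maxMul (J m n)).mkQ (det ^ k * w)} := by
      apply le_antisymm
      · rintro _ ⟨y, hy, rfl⟩
        obtain ⟨c, hc⟩ := hspan y hy
        rw [Submodule.mem_span_singleton]
        refine ⟨c, ?_⟩
        rw [← map_smul]
        exact ((Submodule.Quotient.eq _).2 hc).symm
      · rw [Submodule.span_singleton_le_iff_mem]
        exact ⟨_, hw, rfl⟩
    rw [hmap]
    exact finrank_span_singleton fun h => hnot ((Submodule.Quotient.mk_eq_zero _).1 h)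
  · have hmap : generatingPart weightABCD (J m n) p = ⊥ := by
      rw [eq_bot_iff]
      rintro _ ⟨y, hy, rfl⟩
      exact (Submodule.Quotient.mk_eq_zero _).2 (part_le_maxMul hmn hp hy)
    rw [hmap, finrank_bot]

/-! ### Adding a variable -/

section Extension

variable {σ : Type*}

/-- The extension of an ideal to the polynomial ring with one more variable. -/
def extend (I : Ideal (MvPolynomial σ ℂ)) : Ideal (MvPolynomial (Option σ) ℂ) :=
  I.map (rename some : MvPolynomial σ ℂ →ₐ[ℂ] MvPolynomial (Option σ) ℂ)

/-- The weights of the variables after adding a variable of weight `e`. -/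
def extendWeight (w : σ → ℕ × ℕ) (e : ℕ × ℕ) : Option σ → ℕ × ℕ := fun o => o.elim e w

/-- Setting the additional variable to zero. -/
def forget : MvPolynomial (Option σ) ℂ →ₐ[ℂ] MvPolynomial σ ℂ := aeval fun o => o.elim 0 X

/-- The coefficientwise description is what makes extension commute with intersections. -/
theorem mem_extend_iff {I : Ideal (MvPolynomial σ ℂ)} {f : MvPolynomial (Option σ) ℂ} :
    f ∈ extend I ↔ ∀ k, (optionEquivLeft ℂ σ f).coeff k ∈ I := by
  have h : (extend I).map (optionEquivLeft ℂ σ) = I.map Polynomial.C := by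
    have hcomp : (optionEquivLeft ℂ σ : MvPolynomial (Option σ) ℂ →+* _).comp
        (rename some : MvPolynomial σ ℂ →ₐ[ℂ] _).toRingHom = Polynomial.C := by
      apply MvPolynomial.ringHom_ext <;> simp
    rw [← hcomp]
    exact Ideal.map_map _ _
  rw [← Ideal.mem_map_C_iff, ← h, Ideal.mem_map_of_equiv (optionEquivLeft ℂ σ)]
  constructor
  · exact fun hf => ⟨f, hf, rfl⟩
  · rintro ⟨g, hg, e⟩
    rwa [← (optionEquivLeft ℂ σ).injective e]

theorem extend_inf (I K : Ideal (MvPolynomial σ ℂ)) : extend (I ⊓ K) = extend I ⊓ extend K := by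
  ext f
  simp only [Ideal.mem_inf, mem_extend_iff, forall_and]

theorem rename_mem_extend {I : Ideal (MvPolynomial σ ℂ)} {f : MvPolynomial σ ℂ} (hf : f ∈ I) :
    rename some f ∈ extend I :=
  Ideal.mem_map_of_mem (rename some : MvPolynomial σ ℂ →ₐ[ℂ] MvPolynomial (Option σ) ℂ) hf

theorem forget_eq_coeff (f : MvPolynomial (Option σ) ℂ) :
    forget f = (optionEquivLeft ℂ σ f).coeff 0 := by
  have h : (forget : MvPolynomial (Option σ) ℂ →ₐ[ℂ] MvPolynomial σ ℂ).toRingHom =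
      (Polynomial.constantCoeff).comp (optionEquivLeft ℂ σ : MvPolynomial (Option σ) ℂ →+* _) := by
    apply MvPolynomial.ringHom_ext
    · intro r
      simp [forget, algebraMap_eq]
    · rintro (_ | s) <;> simp [forget]
  exact congrArg (fun g : MvPolynomial (Option σ) ℂ →+* MvPolynomial σ ℂ => g f) h

theorem forget_mem {I : Ideal (MvPolynomial σ ℂ)} {f : MvPolynomial (Option σ) ℂ}
    (hf : f ∈ extend I) : forget f ∈ I := by
  rw [forget_eq_coeff]
  exact mem_extend_iff.1 hf 0

theorem forget_rename (f : MvPolynomial σ ℂ) : forget (rename some f) = f := by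
  rw [forget, aeval_rename]
  exact aeval_X_left_apply f

theorem exists_eq_rename_add_X_mul {I : Ideal (MvPolynomial σ ℂ)} {f : MvPolynomial (Option σ) ℂ}
    (hf : f ∈ extend I) : ∃ g ∈ extend I, f = rename some (forget f) + X none * g := by
  refine ⟨(optionEquivLeft ℂ σ).symm (optionEquivLeft ℂ σ f).divX, ?_, ?_⟩
  · rw [mem_extend_iff] at hf ⊢
    intro k
    rw [AlgEquiv.apply_symm_apply, Polynomial.coeff_divX]
    exact hf _
  · have hC : ∀ g : MvPolynomial σ ℂ, optionEquivLeft ℂ σ (rename some g) = Polynomial.C g := by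
      intro g
      have hcomp : (optionEquivLeft ℂ σ : MvPolynomial (Option σ) ℂ →+* _).comp
          (rename some : MvPolynomial σ ℂ →ₐ[ℂ] _).toRingHom = Polynomial.C := by
        apply MvPolynomial.ringHom_ext <;> simp
      exact congrArg (fun h : MvPolynomial σ ℂ →+* _ => h g) hcomp
    apply (optionEquivLeft ℂ σ).injective
    rw [map_add, map_mul, AlgEquiv.apply_symm_apply, optionEquivLeft_X_none, hC, forget_eq_coeff,
      add_comm, Polynomial.X_mul_divX_add]

variable {w : σ → ℕ × ℕ} {e : ℕ × ℕ}

theorem rename_mem_part {I : Ideal (MvPolynomial σ ℂ)} {p : ℕ × ℕ} {f : MvPolynomial σ ℂ}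
    (hf : f ∈ part w I p) : rename some f ∈ part (extendWeight w e) (extend I) p := by
  refine ⟨rename_mem_extend hf.1, isWeightedHomogeneous_map_algHom (rename some) (fun s => ?_) hf.2⟩
  rw [rename_X]
  exact isWeightedHomogeneous_X ℂ (extendWeight w e) (some s)

theorem forget_mem_part {I : Ideal (MvPolynomial σ ℂ)} {p : ℕ × ℕ} {f : MvPolynomial (Option σ) ℂ}
    (hf : f ∈ part (extendWeight w e) (extend I) p) : forget f ∈ part w I p := by
  refine ⟨forget_mem hf.1, isWeightedHomogeneous_map_algHom forget (fun s => ?_) hf.2⟩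
  rcases s with _ | s
  · simpa [forget] using isWeightedHomogeneous_zero ℂ w _
  · simpa [forget, extendWeight] using isWeightedHomogeneous_X ℂ w s

/-- The part of f that involves the new variable is that variable times an element of the extended
ideal, hence vanishes modulo 𝔪. -/
theorem finrank_generatingPart_extend (I : Ideal (MvPolynomial σ ℂ)) (p : ℕ × ℕ) :
    Module.finrank ℂ (generatingPart (extendWeight w e) (extend I) p) =
      Module.finrank ℂ (generatingPart w I p) := by
  apply finrank_generatingPart_of_retract (rename some) forget forget_rename
    (fun p f => rename_mem_part) (fun p f => forget_mem_part)
  · apply map_maxIdeal_mul_le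
    · intro s
      rw [rename_X]
      exact X_mem_maxIdeal _
    · exact fun f => rename_mem_extend
  · apply map_maxIdeal_mul_le
    · rintro (_ | s)
      · simp [forget]
      · simpa [forget] using X_mem_maxIdeal s
    · exact fun f => forget_mem
  · intro f hf
    obtain ⟨g, hg, h⟩ := exists_eq_rename_add_X_mul hf
    have h' : f - rename some (forget f) = X none * g := by
      rw [sub_eq_iff_eq_add']
      exact h
    rw [h']
    exact Ideal.mul_mem_mul (X_mem_maxIdeal _) hg

theorem map_forget_part (I : Ideal (MvPolynomial σ ℂ)) (p : ℕ × ℕ) :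
    (part (extendWeight w e) (extend I) p).map forget.toLinearMap = part w I p := by
  apply le_antisymm
  · rintro _ ⟨f, hf, rfl⟩
    exact forget_mem_part hf
  · intro f hf
    exact ⟨rename some f, rename_mem_part hf, forget_rename f⟩

theorem eq_X_mul_of_forget_eq_zero {I : Ideal (MvPolynomial σ ℂ)} {p : ℕ × ℕ}
    {f : MvPolynomial (Option σ) ℂ} (hf : f ∈ part (extendWeight w e) (extend I) p)
    (h0 : forget f = 0) :
    f = 0 ∨ e ≤ p ∧ ∃ g ∈ part (extendWeight w e) (extend I) (p - e), f = X none * g := by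
  obtain ⟨g, hg, h⟩ := exists_eq_rename_add_X_mul hf.1
  rw [h0, map_zero, zero_add] at h
  rcases isWeightedHomogeneous_of_mul_left
    (isWeightedHomogeneous_X ℂ (extendWeight w e) none) (X_ne_zero none)
    (h ▸ hf.2) with h' | ⟨hle, h'⟩
  · left; rw [h, h', mul_zero]
  · exact Or.inr ⟨hle, g, ⟨hg, h'⟩, h⟩

/-- Setting the new variable to zero maps onto I, and its kernel is that variable times the extended
ideal. As e ≠ 0, the kernel involves a smaller total degree, so finiteness follows by induction on a
bound N. -/
theorem finrank_part_extend_aux {I : Ideal (MvPolynomial σ ℂ)} (he : e ≠ 0)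
    (hfin : ∀ p, FiniteDimensional ℂ (part w I p)) (N : ℕ) (p : ℕ × ℕ) (hN : p.1 + p.2 < N) :
    FiniteDimensional ℂ (part (extendWeight w e) (extend I) p) ∧
    Module.finrank ℂ (part (extendWeight w e) (extend I) p) = Module.finrank ℂ (part w I p) +
      if e ≤ p then Module.finrank ℂ (part (extendWeight w e) (extend I) (p - e)) else 0 := by
  induction N generalizing p with
  | zero => omega
  | succ N ih =>
    have hmap := map_forget_part (w := w) (e := e) I p
    have hfin' := hfin p
    rw [← hmap] at hfin' ⊢
    split_ifs with hle
    · have hpos : 0 < e.1 + e.2 := by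
        rcases Nat.eq_zero_or_pos (e.1 + e.2) with h | h
        · exact absurd (Prod.ext (by simp; omega) (by simp; omega)) he
        · exact h
      have h1 := hle.1
      have h2 := hle.2
      have hfin'' := (ih (p - e) (by simp only [Prod.fst_sub, Prod.snd_sub]; omega)).1
      apply finrank_of_ker_eq_map _ forget.toLinearMap (LinearMap.mulLeft ℂ (X none))
        (fun _ _ h => mul_left_cancel₀ (X_ne_zero none) h)
      apply le_antisymm
      · rintro f ⟨hf, h0⟩
        rcases eq_X_mul_of_forget_eq_zero hf h0 with rfl | ⟨-, g, hg, rfl⟩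
        exacts [zero_mem _, ⟨g, hg, rfl⟩]
      · rintro _ ⟨g, hg, rfl⟩
        refine ⟨⟨Ideal.mul_mem_left _ _ hg.1, ?_⟩, by simp [forget]⟩
        have := (isWeightedHomogeneous_X ℂ (extendWeight w e) none).mul hg.2
        rwa [show extendWeight w e none = e from rfl, add_tsub_cancel_of_le hle] at this
    · rw [← finrank_bot ℂ (MvPolynomial (Option σ) ℂ)]
      apply finrank_of_ker_eq_map _ forget.toLinearMap LinearMap.id Function.injective_id
      rw [Submodule.map_bot, eq_bot_iff]
      rintro f ⟨hf, h0⟩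
      exact (eq_X_mul_of_forget_eq_zero hf h0).resolve_right fun h => hle h.1

theorem finiteDimensional_part_extend {I : Ideal (MvPolynomial σ ℂ)} (he : e ≠ 0)
    (hfin : ∀ p, FiniteDimensional ℂ (part w I p)) (p : ℕ × ℕ) :
    FiniteDimensional ℂ (part (extendWeight w e) (extend I) p) :=
  (finrank_part_extend_aux he hfin _ p (Nat.lt_succ_self _)).1

theorem finrank_part_extend {I : Ideal (MvPolynomial σ ℂ)} (he : e ≠ 0)
    (hfin : ∀ p, FiniteDimensional ℂ (part w I p)) (p : ℕ × ℕ) :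
    Module.finrank ℂ (part (extendWeight w e) (extend I) p) = Module.finrank ℂ (part w I p) +
      if e ≤ p then Module.finrank ℂ (part (extendWeight w e) (extend I) (p - e)) else 0 :=
  (finrank_part_extend_aux he hfin _ p (Nat.lt_succ_self _)).2

end Extension

/-! ### Change of coordinates -/

section Equivalence

variable {σ τ : Type*} {w : σ → ℕ × ℕ} {w' : τ → ℕ × ℕ}
  (φ : MvPolynomial σ ℂ ≃ₐ[ℂ] MvPolynomial τ ℂ)

theorem map_equiv_inf (I K : Ideal (MvPolynomial σ ℂ)) :
    (I ⊓ K).map φ = I.map φ ⊓ K.map φ := by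
  ext f
  obtain ⟨f, rfl⟩ := φ.surjective f
  have key : ∀ L : Ideal (MvPolynomial σ ℂ), φ f ∈ L.map φ ↔ f ∈ L := fun L => by
    rw [Ideal.mem_map_of_equiv]
    exact ⟨fun ⟨g, hg, e⟩ => φ.injective e ▸ hg, fun hf => ⟨f, hf, rfl⟩⟩
  simp only [Ideal.mem_inf, key]

theorem symm_mem_of_mem_map {I : Ideal (MvPolynomial σ ℂ)} {f : MvPolynomial τ ℂ}
    (hf : f ∈ I.map φ) : φ.symm f ∈ I := by
  obtain ⟨g, hg, rfl⟩ := (Ideal.mem_map_of_equiv φ f).1 hf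
  rwa [AlgEquiv.symm_apply_apply]

theorem part_map_equiv (hφ : ∀ s, IsWeightedHomogeneous w' (φ (X s)) (w s))
    (hφ' : ∀ s, IsWeightedHomogeneous w (φ.symm (X s)) (w' s))
    (I : Ideal (MvPolynomial σ ℂ)) (p : ℕ × ℕ) :
    part w' (I.map φ) p = (part w I p).map φ.toLinearMap := by
  apply le_antisymm
  · intro f hf
    exact ⟨φ.symm f, ⟨symm_mem_of_mem_map φ hf.1,
      isWeightedHomogeneous_map_algHom φ.symm.toAlgHom hφ' hf.2⟩, by simp⟩
  · rintro _ ⟨f, hf, rfl⟩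
    exact ⟨Ideal.mem_map_of_mem φ hf.1,
      isWeightedHomogeneous_map_algHom φ.toAlgHom hφ hf.2⟩

theorem finrank_part_map_equiv (hφ : ∀ s, IsWeightedHomogeneous w' (φ (X s)) (w s))
    (hφ' : ∀ s, IsWeightedHomogeneous w (φ.symm (X s)) (w' s))
    (I : Ideal (MvPolynomial σ ℂ)) (p : ℕ × ℕ) :
    Module.finrank ℂ (part w' (I.map φ) p) = Module.finrank ℂ (part w I p) := by
  rw [part_map_equiv φ hφ hφ']
  exact (Submodule.equivMapOfInjective φ.toLinearMap φ.injective _).finrank_eq.symm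

theorem finrank_generatingPart_map_equiv (hφ : ∀ s, IsWeightedHomogeneous w' (φ (X s)) (w s))
    (hφ' : ∀ s, IsWeightedHomogeneous w (φ.symm (X s)) (w' s))
    (hm : ∀ s, φ (X s) ∈ maxIdeal τ)
    (hm' : ∀ s, φ.symm (X s) ∈ maxIdeal σ) (I : Ideal (MvPolynomial σ ℂ)) (p : ℕ × ℕ) :
    Module.finrank ℂ (generatingPart w' (I.map φ) p) =
      Module.finrank ℂ (generatingPart w I p) := by
  apply finrank_generatingPart_of_retract (φ : MvPolynomial σ ℂ →ₐ[ℂ] MvPolynomial τ ℂ)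
    (φ.symm : MvPolynomial τ ℂ →ₐ[ℂ] MvPolynomial σ ℂ)
  · simp
  · intro p f hf
    rw [part_map_equiv φ hφ hφ']
    exact ⟨f, hf, rfl⟩
  · intro p f hf
    rw [part_map_equiv φ hφ hφ'] at hf
    obtain ⟨g, hg, rfl⟩ := hf
    simpa using hg
  · exact map_maxIdeal_mul_le (φ : MvPolynomial σ ℂ →ₐ[ℂ] MvPolynomial τ ℂ) hm
      fun f hf => Ideal.mem_map_of_mem φ hf
  · exact map_maxIdeal_mul_le (φ.symm : MvPolynomial τ ℂ →ₐ[ℂ] MvPolynomial σ ℂ) hm'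
      fun f hf => symm_mem_of_mem_map φ hf
  · intro f _
    simp

end Equivalence

/-- The linear change of coordinates `a = t₁ - t₂`, `b = x₁ - x₂`, `c = t₃ - t₂`, `d = x₃ - x₂` with
the additional coordinates `t₂` and `x₂`. -/
def coordinates : MvPolynomial (Option (Option (Fin 4))) ℂ ≃ₐ[ℂ] MvPolynomial (Fin 3 ⊕ Fin 3) ℂ :=
  AlgEquiv.ofAlgHom
    (aeval fun o => o.elim (X (.inr 1)) fun o => o.elim (X (.inl 1))
      ![X (.inl 0) - X (.inl 1), X (.inr 0) - X (.inr 1),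
        X (.inl 2) - X (.inl 1), X (.inr 2) - X (.inr 1)])
    (aeval (Sum.elim
      ![X (some (some 0)) + X (some none), X (some none), X (some (some 2)) + X (some none)]
      ![X (some (some 1)) + X none, X none, X (some (some 3)) + X none]))
    (by
      apply MvPolynomial.algHom_ext
      rintro (s | s) <;> fin_cases s <;> simp)
    (by
      apply MvPolynomial.algHom_ext
      rintro (_ | _ | s)
      · simp
      · simp
      · fin_cases s <;> simp)

theorem coordinates_symm_apply_X (s : Fin 3 ⊕ Fin 3) : coordinates.symm (X s) = Sum.elim
    ![X (some (some 0)) + X (some none), X (some none), X (some (some 2)) + X (some none)]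
    ![X (some (some 1)) + X none, X none, X (some (some 3)) + X none] s := by
  change aeval _ (X s) = _
  rw [aeval_X]

theorem coordinates_apply_X (s : Option (Option (Fin 4))) : coordinates (X s) =
    s.elim (X (.inr 1)) fun o => o.elim (X (.inl 1))
      ![X (.inl 0) - X (.inl 1), X (.inr 0) - X (.inr 1),
        X (.inl 2) - X (.inl 1), X (.inr 2) - X (.inr 1)] := by
  change aeval _ (X s) = _
  rw [aeval_X]

/-- The weights of the six coordinates. -/
def coordinateWeight : Option (Option (Fin 4)) → ℕ × ℕ :=
  extendWeight (extendWeight weightABCD (1, 0)) (0, 1)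

theorem isWeightedHomogeneous_coordinates (s : Option (Option (Fin 4))) :
    IsWeightedHomogeneous (weightTX 3) (coordinates (X s)) (coordinateWeight s) := by
  have h := isWeightedHomogeneous_X ℂ (weightTX 3)
  rw [coordinates_apply_X]
  rcases s with _ | _ | s
  · exact h _
  · exact h _
  · fin_cases s
    exacts [(h (.inl 0)).sub (h (.inl 1)), (h (.inr 0)).sub (h (.inr 1)),
      (h (.inl 2)).sub (h (.inl 1)), (h (.inr 2)).sub (h (.inr 1))]

theorem isWeightedHomogeneous_coordinates_symm (s : Fin 3 ⊕ Fin 3) :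
    IsWeightedHomogeneous coordinateWeight (coordinates.symm (X s)) (weightTX 3 s) := by
  have h := isWeightedHomogeneous_X ℂ coordinateWeight
  rw [coordinates_symm_apply_X]
  rcases s with s | s <;> fin_cases s
  exacts [(h (some (some 0))).add (h (some none)), h (some none),
    (h (some (some 2))).add (h (some none)), (h (some (some 1))).add (h none), h none,
    (h (some (some 3))).add (h none)]

theorem coordinates_mem_maxIdeal (s : Option (Option (Fin 4))) :
    coordinates (X s) ∈ maxIdeal (Fin 3 ⊕ Fin 3) := by
  rw [coordinates_apply_X]
  rcases s with _ | _ | s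
  · exact X_mem_maxIdeal _
  · exact X_mem_maxIdeal _
  · fin_cases s <;> exact sub_mem (X_mem_maxIdeal _) (X_mem_maxIdeal _)

theorem coordinates_symm_mem_maxIdeal (s : Fin 3 ⊕ Fin 3) :
    coordinates.symm (X s) ∈ maxIdeal (Option (Option (Fin 4))) := by
  rw [coordinates_symm_apply_X]
  rcases s with s | s <;> fin_cases s
  exacts [add_mem (X_mem_maxIdeal _) (X_mem_maxIdeal _), X_mem_maxIdeal _,
    add_mem (X_mem_maxIdeal _) (X_mem_maxIdeal _), add_mem (X_mem_maxIdeal _) (X_mem_maxIdeal _),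
    X_mem_maxIdeal _, add_mem (X_mem_maxIdeal _) (X_mem_maxIdeal _)]

theorem map_coordinates_span_pow (x y : PolyABCD) (n : ℕ) :
    (extend (extend (Ideal.span {x, y} ^ n))).map coordinates =
      Ideal.span {coordinates (rename some (rename some x)),
        coordinates (rename some (rename some y))} ^ n := by
  simp only [extend, Ideal.map_pow, Ideal.map_span, Set.image_pair]

theorem span_pair_sub_comm {R : Type*} [CommRing R] (a b c d : R) :
    Ideal.span {a - b, c - d} = Ideal.span {b - a, d - c} := by
  have key : ∀ a b c d : R, Ideal.span {a - b, c - d} ≤ Ideal.span {b - a, d - c} := by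
    intro a b c d
    rw [Ideal.span_le]
    rintro x (rfl | rfl)
    · exact neg_sub b a ▸ neg_mem (mem_span_pair_left (b - a) (d - c))
    · exact neg_sub d c ▸ neg_mem (mem_span_pair_right (b - a) (d - c))
  exact le_antisymm (key _ _ _ _) (key _ _ _ _)

/-- The differences of t₁, t₂, t₃ are a, c and a - c up to sign, similarly for the x's. The ordering
makes the minima d₁, d₂ and d₁, so d₃ plays no role. -/
theorem JPrime_eq_map {d₁ d₂ d₃ : ℕ} (h₁₂ : d₁ ≤ d₂) (h₂₃ : d₂ ≤ d₃) :
    JPrime ![d₁, d₂, d₃] = (extend (extend (J d₁ d₂))).map coordinates := by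
  rw [J, extend_inf, extend_inf, extend_inf, extend_inf, map_equiv_inf, map_equiv_inf,
    map_coordinates_span_pow, map_coordinates_span_pow, map_coordinates_span_pow]
  simp only [map_sub, rename_X, coordinates_apply_X]
  simp only [Option.elim, Matrix.cons_val, sub_sub_sub_cancel_right]
  let P : Fin 3 → Fin 3 → Ideal (MvPolynomial (Fin 3 ⊕ Fin 3) ℂ) := fun i j =>
    Ideal.span {X (.inl i) - X (.inl j), X (.inr i) - X (.inr j)}
  have hP : ∀ i j, P i j = P j i := fun i j => span_pair_sub_comm _ _ _ _
  ext f
  have key : f ∈ JPrime ![d₁, d₂, d₃] ↔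
      ∀ i j, i ≠ j → f ∈ P i j ^ min (![d₁, d₂, d₃] i) (![d₁, d₂, d₃] j) := by
    simp only [JPrime, Ideal.mem_iInf]
    rfl
  rw [key]
  change _ ↔ f ∈ P 0 1 ^ d₁ ⊓ P 2 1 ^ d₂ ⊓ P 0 2 ^ d₁
  have m12 : min d₁ d₂ = d₁ := min_eq_left h₁₂
  have m13 : min d₁ d₃ = d₁ := min_eq_left (h₁₂.trans h₂₃)
  have m23 : min d₂ d₃ = d₂ := min_eq_left h₂₃
  simp only [Ideal.mem_inf]
  constructor
  · intro h
    refine ⟨⟨?_, ?_⟩, ?_⟩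
    · simpa [m12] using h 0 1 (by decide)
    · simpa [m23, min_comm] using h 2 1 (by decide)
    · simpa [m13] using h 0 2 (by decide)
  · rintro ⟨⟨h01, h21⟩, h02⟩ i j hij
    have h10 := hP 0 1 ▸ h01
    have h12 := hP 2 1 ▸ h21
    have h20 := hP 0 2 ▸ h02
    fin_cases i <;> fin_cases j <;> first
      | exact absurd rfl hij
      | simpa [m12, m13, m23, min_comm d₂ d₁, min_comm d₃ d₁, min_comm d₃ d₂]

/-! ### The Hilbert series -/

/-- The Hilbert series of `I`, as the series of dimensions of the pieces inside the polynomial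
ring. -/
def partSeries {σ : Type*} (w : σ → ℕ × ℕ) (I : Ideal (MvPolynomial σ ℂ)) : SeriesQT :=
  seriesOf fun p => (Module.finrank ℂ (part w I p) : ℚ)

theorem hilbertSeries_idealPiece {σ : Type*} (w : σ → ℕ × ℕ) (I : Ideal (MvPolynomial σ ℂ)) :
    hilbertSeries (idealPiece w I) = partSeries w I := by
  funext e
  exact congrArg Nat.cast (finrank_idealPiece w I _)

theorem hilbertSeries_generatingPiece {σ : Type*} (w : σ → ℕ × ℕ) (I : Ideal (MvPolynomial σ ℂ)) :
    hilbertSeries (generatingPiece w I) =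
      seriesOf fun p => (Module.finrank ℂ (generatingPart w I p) : ℚ) := by
  funext e
  exact congrArg Nat.cast (finrank_generatingPiece w I _)

theorem partSeries_J (m n : ℕ) :
    partSeries weightABCD (J m n) = truncatedSeries (2 * m + n) +
      MvPowerSeries.X 0 * MvPowerSeries.X 1 * partSeries weightABCD (J (m - 1) (n - 1)) := by
  have h := monomial_mul_seriesOf 1 1 fun p =>
    (Module.finrank ℂ (part weightABCD (J (m - 1) (n - 1)) p) : ℚ)
  rw [pow_one, pow_one] at h
  rw [partSeries, partSeries, h, truncatedSeries, seriesOf_add]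
  congr 1
  funext p
  rw [finrank_part_J]
  push_cast
  rfl

theorem partSeries_extend {σ : Type*} {w : σ → ℕ × ℕ} {i j : ℕ} (he : (i, j) ≠ (0, 0))
    {I : Ideal (MvPolynomial σ ℂ)} (hfin : ∀ p, FiniteDimensional ℂ (part w I p)) :
    (1 - MvPowerSeries.X 0 ^ i * MvPowerSeries.X 1 ^ j) *
      partSeries (extendWeight w (i, j)) (extend I) = partSeries w I := by
  rw [sub_mul, one_mul, sub_eq_iff_eq_add, partSeries, monomial_mul_seriesOf, partSeries,
    seriesOf_add]
  congr 1
  funext p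
  rw [finrank_part_extend he hfin]
  push_cast
  rfl

theorem partSeries_JPrime {d₁ d₂ d₃ : ℕ} (h₁₂ : d₁ ≤ d₂) (h₂₃ : d₂ ≤ d₃) :
    (1 - MvPowerSeries.X 0) * (1 - MvPowerSeries.X 1) *
      partSeries (weightTX 3) (JPrime ![d₁, d₂, d₃]) = partSeries weightABCD (J d₁ d₂) := by
  have h0 : partSeries (weightTX 3) (JPrime ![d₁, d₂, d₃]) =
      partSeries coordinateWeight (extend (extend (J d₁ d₂))) := by
    rw [JPrime_eq_map h₁₂ h₂₃, partSeries]
    simp only [finrank_part_map_equiv coordinates isWeightedHomogeneous_coordinates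
      isWeightedHomogeneous_coordinates_symm]
    rfl
  have hfin := finiteDimensional_part_J d₁ d₂
  have h1 := partSeries_extend (i := 1) (j := 0) (by simp) hfin
  have h2 := partSeries_extend (i := 0) (j := 1) (by simp)
    (finiteDimensional_part_extend (e := (1, 0)) (by simp) hfin)
  rw [pow_one, pow_zero, mul_one] at h1
  rw [pow_one, pow_zero, one_mul] at h2
  rw [h0, mul_assoc, coordinateWeight, h2, h1]

open scoped Classical in
/-- The generating function of the degrees of the minimal generators of `J(m, n)`. -/
def generatorSeries (m n : ℕ) : SeriesQT :=
  seriesOf fun p => if IsGeneratorDegree m n p then 1 else 0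

theorem hilbertSeries_generatingPiece_JPrime {d₁ d₂ d₃ : ℕ} (h₁₂ : d₁ ≤ d₂) (h₂₃ : d₂ ≤ d₃) :
    hilbertSeries (generatingPiece (weightTX 3) (JPrime ![d₁, d₂, d₃])) =
      generatorSeries d₁ d₂ := by
  rw [hilbertSeries_generatingPiece, JPrime_eq_map h₁₂ h₂₃, generatorSeries]
  congr 1
  funext p
  rw [finrank_generatingPart_map_equiv coordinates isWeightedHomogeneous_coordinates
    isWeightedHomogeneous_coordinates_symm coordinates_mem_maxIdeal coordinates_symm_mem_maxIdeal,
    coordinateWeight, finrank_generatingPart_extend, finrank_generatingPart_extend,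
    finrank_generatingPart_J h₁₂]
  push_cast
  rfl

theorem generatorSeries_zero (n : ℕ) : generatorSeries 0 n = completeSeries n := by
  classical
  rw [generatorSeries, completeSeries]
  congr 1
  funext p
  congr 1
  rw [IsGeneratorDegree, eq_iff_iff]
  constructor
  · rintro ⟨k, hk, -, h⟩
    omega
  · intro h
    exact ⟨0, le_rfl, ⟨Nat.zero_le _, Nat.zero_le _⟩, by omega⟩

/-- The first summand collects k = 0 and the second k ≥ 1, shifted by one. They do not overlap
because the total degree determines k. -/
theorem generatorSeries_succ_succ (m n : ℕ) :
    generatorSeries (m + 1) (n + 1) = completeSeries (2 * m + n + 3) +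
      MvPowerSeries.X 0 * MvPowerSeries.X 1 * generatorSeries m n := by
  classical
  have h := monomial_mul_seriesOf 1 1 fun p => if IsGeneratorDegree m n p then (1 : ℚ) else 0
  rw [pow_one, pow_one] at h
  rw [generatorSeries, generatorSeries, h, completeSeries, seriesOf_add]
  congr 1
  funext p
  have hiff : IsGeneratorDegree (m + 1) (n + 1) p ↔
      p.1 + p.2 = 2 * m + n + 3 ∨ (1, 1) ≤ p ∧ IsGeneratorDegree m n (p - (1, 1)) := by
    simp only [IsGeneratorDegree, Prod.le_def, Prod.fst_sub, Prod.snd_sub]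
    constructor
    · rintro ⟨_ | k, h1, h2, h3⟩
      · exact Or.inl (by omega)
      · exact Or.inr ⟨by omega, k, by omega, by omega, by omega⟩
    · rintro (h | ⟨h1, k, h2, h3, h4⟩)
      · exact ⟨0, by omega, by omega, by omega⟩
      · exact ⟨k + 1, by omega, by omega, by omega⟩
  have hnot : p.1 + p.2 = 2 * m + n + 3 → ¬ ((1, 1) ≤ p ∧ IsGeneratorDegree m n (p - (1, 1))) := by
    rintro h ⟨h1, k, h2, h3, h4⟩
    simp only [Prod.le_def, Prod.fst_sub, Prod.snd_sub] at h1 h4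
    omega
  simp only [hiff]
  by_cases h1 : p.1 + p.2 = 2 * m + n + 3
  · have := hnot h1
    simp only [h1, true_or, if_true]
    split_ifs with h2 h3
    · exact absurd ⟨h2, h3⟩ this
    · simp
    · simp
  · simp only [h1, false_or, if_false, zero_add, ite_and]

/-! ### Comparison with the rational functions in a field -/

section

variable {K : Type*} [Field K] (φ : SeriesQT →+* K)

theorem map_completeSeries (s : ℕ) :
    (φ (.X 0) - φ (.X 1)) * φ (completeSeries s) = φ (.X 0) ^ (s + 1) - φ (.X 1) ^ (s + 1) := by
  simpa only [map_mul, map_sub, map_pow] using congrArg φ (completeSeries_eq s)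

theorem map_truncatedSeries (s : ℕ) :
    (φ (.X 0) - φ (.X 1)) * (1 - φ (.X 0)) ^ 2 * (1 - φ (.X 1)) ^ 2 * φ (truncatedSeries s) =
      φ (.X 0) ^ (s + 1) * (1 - φ (.X 1)) ^ 2 - φ (.X 1) ^ (s + 1) * (1 - φ (.X 0)) ^ 2 := by
  simpa only [map_mul, map_sub, map_pow, map_one] using congrArg φ (truncatedSeries_eq s)

variable {φ}

theorem map_generatorSeries (h : Generic (φ (.X 0)) (φ (.X 1))) {m n : ℕ} (hmn : m ≤ n) :
    φ (generatorSeries m n) = generatingRat (φ (.X 0)) (φ (.X 1)) m n := by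
  have h3 := h.one_sub_ne.2.2.1
  induction m generalizing n with
  | zero =>
    apply mul_left_cancel₀ h3
    rw [generatorSeries_zero, map_completeSeries, generatingRat_zero h]
  | succ m ih =>
    obtain ⟨n, rfl⟩ : ∃ n', n = n' + 1 := ⟨n - 1, by omega⟩
    apply mul_left_cancel₀ h3
    have h1 := generatingRat_succ_succ h m n
    have h2 := map_completeSeries φ (2 * m + n + 3)
    rw [generatorSeries_succ_succ, map_add, map_mul, map_mul, ih (by omega)]
    linear_combination h2 - h1

theorem map_partSeries_J (h : Generic (φ (.X 0)) (φ (.X 1))) {m n : ℕ} (hmn : m ≤ n) :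
    φ (partSeries weightABCD (J m n)) = hilbertRat (φ (.X 0)) (φ (.X 1)) m n := by
  obtain ⟨h1, h2, h3, -⟩ := h.one_sub_ne
  have hne : (φ (.X 0) - φ (.X 1)) * (1 - φ (.X 0)) ^ 2 * (1 - φ (.X 1)) ^ 2 ≠ 0 :=
    mul_ne_zero (mul_ne_zero h3 (pow_ne_zero _ h1)) (pow_ne_zero _ h2)
  -- The induction is on n because m - 1 stays at 0 once m = 0, while n still decreases.
  induction n generalizing m with
  | zero =>
    obtain rfl : m = 0 := by omega
    have hJ := congrArg φ (partSeries_J 0 0)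
    rw [map_add, map_mul, map_mul] at hJ
    have e1 := hilbertRat_zero_zero h
    have e2 := map_truncatedSeries φ (2 * 0 + 0)
    -- For m = n = 0 the recursion refers to itself and determines the series only after division by
    -- 1 - qt.
    have hqt : 1 - φ (.X 0) * φ (.X 1) ≠ 0 := sub_ne_zero.2 h.mul_ne_one.symm
    apply mul_left_cancel₀ hne
    apply mul_left_cancel₀ hqt
    linear_combination e2 - e1 +
      ((φ (.X 0) - φ (.X 1)) * (1 - φ (.X 0)) ^ 2 * (1 - φ (.X 1)) ^ 2) * hJ
  | succ n ih =>
    apply mul_left_cancel₀ hne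
    rw [partSeries_J, map_add, map_mul, map_mul, Nat.add_sub_cancel,
      ih (show m - 1 ≤ n by omega)]
    rcases m with _ | m
    · have e1 := hilbertRat_zero_succ h n
      have e2 := map_truncatedSeries φ (2 * 0 + (n + 1))
      rw [show 2 * 0 + (n + 1) + 1 = n + 2 by ring] at e2
      rw [Nat.zero_sub]
      linear_combination e2 - e1
    · have e1 := hilbertRat_succ_succ h m n
      have e2 := map_truncatedSeries φ (2 * (m + 1) + (n + 1))
      rw [show 2 * (m + 1) + (n + 1) + 1 = 2 * m + n + 4 by ring] at e2
      rw [Nat.add_sub_cancel]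
      linear_combination e2 - e1

end

/-! ### The sums over standard tableaux with three boxes -/

theorem standardTableaux_three : standardTableaux 3 =
    {![(0, 0), (0, 1), (0, 2)], ![(0, 0), (1, 0), (2, 0)], ![(0, 0), (0, 1), (1, 0)],
      ![(0, 0), (1, 0), (0, 1)]} := by
  decide +kernel

theorem factor_of_ne {x : RatQT} (h : x ≠ 1) : factor x = 1 - x := if_neg h

theorem factor_one : factor 1 = 1 := if_pos rfl

theorem omega_of_ne {x : RatQT} (h : x ≠ 1) (h' : q * t * x ≠ 1) (hq : q * x ≠ 1) (ht : t * x ≠ 1) :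
    omega x = (1 - x) * (1 - q * t * x) / ((1 - q * x) * (1 - t * x)) := by
  rw [omega, factor_of_ne h, factor_of_ne h', factor_of_ne hq, factor_of_ne ht]

theorem omega_of_q_mul_eq_one {x : RatQT} (h : x ≠ 1) (h' : q * t * x ≠ 1) (hq : q * x = 1)
    (ht : t * x ≠ 1) : omega x = (1 - x) * (1 - q * t * x) / (1 - t * x) := by
  rw [omega, factor_of_ne h, factor_of_ne h', hq, factor_one, factor_of_ne ht, one_mul]

theorem omega_of_t_mul_eq_one {x : RatQT} (h : x ≠ 1) (h' : q * t * x ≠ 1) (hq : q * x ≠ 1)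
    (ht : t * x = 1) : omega x = (1 - x) * (1 - q * t * x) / (1 - q * x) := by
  rw [omega, factor_of_ne h, factor_of_ne h', ht, factor_one, factor_of_ne hq, mul_one]

theorem div_ne_one_of_ne' {x y : RatQT} (hy : y ≠ 0) (h : x ≠ y) : x / y ≠ 1 := by
  rwa [ne_eq, div_eq_one_iff_eq hy]

/-- Here the convention on ignored factors intervenes: the denominator factor 1 - qx is 1 - 1. -/
theorem omega_inv_q : omega q⁻¹ = (q - 1) * (1 - t) / (q - t) := by
  have h := generic_q_t
  obtain ⟨h1, h2, h3, h4, h5, h6, h7, h8⟩ := h.one_sub_ne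
  have hq := h.q_ne_zero
  have e1 : q * t * q⁻¹ = t := by field_simp
  have e2 : t * q⁻¹ = t / q := rfl
  rw [omega_of_q_mul_eq_one (inv_ne_one.2 h.q_ne_one) (by rw [e1]; exact h.t_ne_one)
    (mul_inv_cancel₀ hq) (by rw [e2]; exact div_ne_one_of_ne' hq h.q_ne_t.symm), e1, e2]
  field_simp

theorem omega_inv_t : omega t⁻¹ = (t - 1) * (1 - q) / (t - q) := by
  have h := generic_q_t
  obtain ⟨h1, h2, h3, h4, h5, h6, h7, h8⟩ := h.one_sub_ne
  have ht := h.t_ne_zero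
  have e1 : q * t * t⁻¹ = q := by field_simp
  have e2 : q * t⁻¹ = q / t := rfl
  rw [omega_of_t_mul_eq_one (inv_ne_one.2 h.t_ne_one) (by rw [e1]; exact h.q_ne_one)
    (by rw [e2]; exact div_ne_one_of_ne' ht h.q_ne_t) (mul_inv_cancel₀ ht), e1, e2]
  field_simp

theorem omega_inv_q_sq : omega (q ^ 2)⁻¹ = (q + 1) * (q - t) / (q ^ 2 - t) := by
  have h := generic_q_t
  obtain ⟨h1, h2, h3, h4, h5, h6, h7, h8⟩ := h.one_sub_ne
  have hq := h.q_ne_zero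
  have e1 : q * t * (q ^ 2)⁻¹ = t / q := by field_simp
  have e2 : q * (q ^ 2)⁻¹ = q⁻¹ := by field_simp
  have e3 : t * (q ^ 2)⁻¹ = t / q ^ 2 := rfl
  have h1' : q - 1 ≠ 0 := sub_ne_zero.2 h.q_ne_one
  have e4 : 1 - q⁻¹ = (q - 1) / q := by field_simp
  rw [omega_of_ne (inv_ne_one.2 h.q_sq_ne_one)
    (by rw [e1]; exact div_ne_one_of_ne' hq h.q_ne_t.symm)
    (by rw [e2]; exact inv_ne_one.2 h.q_ne_one)
    (by rw [e3]; exact div_ne_one_of_ne' (pow_ne_zero 2 hq) h.q_sq_ne_t.symm), e1, e2, e3, e4]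
  field_simp
  ring

theorem omega_inv_t_sq : omega (t ^ 2)⁻¹ = (t + 1) * (t - q) / (t ^ 2 - q) := by
  have h := generic_q_t
  obtain ⟨h1, h2, h3, h4, h5, h6, h7, h8⟩ := h.one_sub_ne
  have ht := h.t_ne_zero
  have e1 : q * t * (t ^ 2)⁻¹ = q / t := by field_simp
  have e2 : t * (t ^ 2)⁻¹ = t⁻¹ := by field_simp
  have e3 : q * (t ^ 2)⁻¹ = q / t ^ 2 := rfl
  have h1' : t - 1 ≠ 0 := sub_ne_zero.2 h.t_ne_one
  have e4 : 1 - t⁻¹ = (t - 1) / t := by field_simp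
  rw [omega_of_ne (inv_ne_one.2 h.t_sq_ne_one)
    (by rw [e1]; exact div_ne_one_of_ne' ht h.q_ne_t)
    (by rw [e3]; exact div_ne_one_of_ne' (pow_ne_zero 2 ht) h.t_sq_ne_q.symm)
    (by rw [e2]; exact inv_ne_one.2 h.t_ne_one), e1, e2, e3, e4]
  field_simp
  ring

theorem omega_q_div_t : omega (q / t) = (t - q) * (1 + q) / (t - q ^ 2) := by
  have h := generic_q_t
  obtain ⟨h1, h2, h3, h4, h5, h6, h7, h8⟩ := h.one_sub_ne
  have ht := h.t_ne_zero
  have e1 : q * t * (q / t) = q ^ 2 := by field_simp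
  have e2 : q * (q / t) = q ^ 2 / t := by ring
  have e3 : t * (q / t) = q := by field_simp
  rw [omega_of_ne (div_ne_one_of_ne' ht h.q_ne_t) (by rw [e1]; exact h.q_sq_ne_one)
    (by rw [e2]; exact div_ne_one_of_ne' ht h.q_sq_ne_t) (by rw [e3]; exact h.q_ne_one), e1, e2, e3]
  field_simp
  ring

theorem omega_t_div_q : omega (t / q) = (q - t) * (1 + t) / (q - t ^ 2) := by
  have h := generic_q_t
  obtain ⟨h1, h2, h3, h4, h5, h6, h7, h8⟩ := h.one_sub_ne
  have hq := h.q_ne_zero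
  have e1 : q * t * (t / q) = t ^ 2 := by field_simp
  have e2 : t * (t / q) = t ^ 2 / q := by ring
  have e3 : q * (t / q) = t := by field_simp
  rw [omega_of_ne (div_ne_one_of_ne' hq h.q_ne_t.symm) (by rw [e1]; exact h.t_sq_ne_one)
    (by rw [e3]; exact h.t_ne_one) (by rw [e2]; exact div_ne_one_of_ne' hq h.t_sq_ne_q), e1, e2, e3]
  field_simp
  ring

theorem factor_inv_q : factor q⁻¹ = (q - 1) / q := by
  have hq := generic_q_t.q_ne_zero
  rw [factor_of_ne (inv_ne_one.2 generic_q_t.q_ne_one)]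
  field_simp

theorem factor_inv_t : factor t⁻¹ = (t - 1) / t := by
  have ht := generic_q_t.t_ne_zero
  rw [factor_of_ne (inv_ne_one.2 generic_q_t.t_ne_one)]
  field_simp

theorem factor_inv_q_sq : factor (q ^ 2)⁻¹ = (q ^ 2 - 1) / q ^ 2 := by
  have hq := generic_q_t.q_ne_zero
  rw [factor_of_ne (inv_ne_one.2 generic_q_t.q_sq_ne_one)]
  field_simp

theorem factor_inv_t_sq : factor (t ^ 2)⁻¹ = (t ^ 2 - 1) / t ^ 2 := by
  have ht := generic_q_t.t_ne_zero
  rw [factor_of_ne (inv_ne_one.2 generic_q_t.t_sq_ne_one)]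
  field_simp

theorem prod_prod_Ioi_three (f : Fin (2 + 1) → Fin (2 + 1) → RatQT) :
    ∏ i, ∏ j ∈ Finset.Ioi i, f i j = f 0 1 * f 0 2 * f 1 2 := by
  have h0 : Finset.Ioi (0 : Fin 3) = {1, 2} := by decide
  have h1 : Finset.Ioi (1 : Fin 3) = {2} := by decide
  have h2 : Finset.Ioi (2 : Fin 3) = ∅ := by decide
  rw [Fin.prod_univ_three, h0, h1, h2, Finset.prod_pair (by decide), Finset.prod_singleton,
    Finset.prod_empty, mul_one]

theorem sum_standardTableaux_three (f : (Fin 3 → Fin 3 × Fin 3) → RatQT) :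
    ∑ T ∈ standardTableaux 3, f T = f ![(0, 0), (0, 1), (0, 2)] + f ![(0, 0), (1, 0), (2, 0)] +
      f ![(0, 0), (0, 1), (1, 0)] + f ![(0, 0), (1, 0), (0, 1)] := by
  rw [standardTableaux_three, Finset.sum_insert (by decide), Finset.sum_insert (by decide),
    Finset.sum_pair (by decide)]
  ring

theorem prod_three (f : Fin (2 + 1) → RatQT) : ∏ i, f i = f 0 * f 1 * f 2 :=
  Fin.prod_univ_three f

/-- The summand of `H(d₁, d₂, d₃)` for a tableau with contents `1, x, y`. -/
def hilbertTerm (d₁ d₂ : ℕ) (x y : RatQT) : RatQT :=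
  (x ^ d₂ * y ^ d₁) / ((1 - q) ^ 3 * (1 - t) ^ 3) * (1 / factor x⁻¹ * (1 / factor y⁻¹)) *
    (omega x⁻¹ * omega y⁻¹ * omega (x / y))

/-- The summand of `F(d₁, d₂, d₃)` for a tableau with contents `1, x, y`. -/
def generatingTerm (d₁ d₂ : ℕ) (x y : RatQT) : RatQT :=
  (x ^ d₂ * y ^ d₁) * (1 / (factor x⁻¹ * factor (q * t / x)) *
    (1 / (factor y⁻¹ * factor (q * t * x / y)))) *
    (omega x⁻¹ * omega y⁻¹ * omega (x / y))

/-- The label in the corner has content 1, so d₃ disappears. The four terms come from the row, the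
column and the two tableaux of hook shape. -/
theorem H_eq_sum_hilbertTerm (d₁ d₂ d₃ : ℕ) : H ![d₁, d₂, d₃] =
    hilbertTerm d₁ d₂ q (q ^ 2) + hilbertTerm d₁ d₂ t (t ^ 2) +
      hilbertTerm d₁ d₂ q t + hilbertTerm d₁ d₂ t q := by
  rw [H, sum_standardTableaux_three]
  simp only [prod_prod_Ioi_three]
  simp only [Fin.prod_univ_two, prod_three, hilbertTerm]
  simp [content, Fin.rev]

theorem F_eq_sum_generatingTerm (d₁ d₂ d₃ : ℕ) : F ![d₁, d₂, d₃] =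
    generatingTerm d₁ d₂ q (q ^ 2) + generatingTerm d₁ d₂ t (t ^ 2) +
      generatingTerm d₁ d₂ q t + generatingTerm d₁ d₂ t q := by
  rw [F, sum_standardTableaux_three]
  simp only [prod_prod_Ioi_three]
  simp only [Fin.prod_univ_two, prod_three, generatingTerm]
  simp [content, Fin.rev]

theorem hilbertTerm_row (m n : ℕ) : (1 - q) * (1 - t) * hilbertTerm m n q (q ^ 2) =
    q ^ (2 * m + n) * q ^ 3 / ((1 - q) ^ 2 * (q - t) * (q ^ 2 - t)) := by
  have h := generic_q_t
  obtain ⟨h1, h2, h3, h4, h5, h6, h7, h8⟩ := h.one_sub_ne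
  have hq := h.q_ne_zero
  have h1' : q - 1 ≠ 0 := sub_ne_zero.2 h.q_ne_one
  have h9 : q ^ 2 - 1 ≠ 0 := sub_ne_zero.2 h.q_sq_ne_one
  have e : q / q ^ 2 = q⁻¹ := by field_simp
  rw [hilbertTerm, factor_inv_q, factor_inv_q_sq, omega_inv_q, omega_inv_q_sq, e, omega_inv_q,
    pow_add q, pow_mul q 2 m]
  field_simp
  ring

theorem hilbertTerm_col (m n : ℕ) : (1 - q) * (1 - t) * hilbertTerm m n t (t ^ 2) =
    - (t ^ (2 * m + n) * t ^ 3 / ((1 - t) ^ 2 * (q - t) * (t ^ 2 - q))) := by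
  have h := generic_q_t
  obtain ⟨h1, h2, h3, h4, h5, h6, h7, h8⟩ := h.one_sub_ne
  have ht := h.t_ne_zero
  have h1' : t - 1 ≠ 0 := sub_ne_zero.2 h.t_ne_one
  have h9 : t ^ 2 - 1 ≠ 0 := sub_ne_zero.2 h.t_sq_ne_one
  have e : t / t ^ 2 = t⁻¹ := by field_simp
  rw [hilbertTerm, factor_inv_t, factor_inv_t_sq, omega_inv_t, omega_inv_t_sq, e, omega_inv_t,
    pow_add t, pow_mul t 2 m]
  field_simp
  ring

theorem hilbertTerm_hook (m n : ℕ) : (1 - q) * (1 - t) * hilbertTerm m n q t =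
    - (q ^ n * t ^ m * (1 + q) * (q * t) / ((1 - t) * (1 - q) * (q - t) * (q ^ 2 - t))) := by
  have h := generic_q_t
  obtain ⟨h1, h2, h3, h4, h5, h6, h7, h8⟩ := h.one_sub_ne
  have hq := h.q_ne_zero
  have ht := h.t_ne_zero
  have h1' : q - 1 ≠ 0 := sub_ne_zero.2 h.q_ne_one
  have h2' : t - 1 ≠ 0 := sub_ne_zero.2 h.t_ne_one
  rw [hilbertTerm, factor_inv_q, factor_inv_t, omega_inv_q, omega_inv_t, omega_q_div_t]
  field_simp
  ring

theorem hilbertTerm_hook' (m n : ℕ) : (1 - q) * (1 - t) * hilbertTerm m n t q =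
    q ^ m * t ^ n * (1 + t) * (q * t) / ((1 - q) * (1 - t) * (q - t) * (t ^ 2 - q)) := by
  have h := generic_q_t
  obtain ⟨h1, h2, h3, h4, h5, h6, h7, h8⟩ := h.one_sub_ne
  have hq := h.q_ne_zero
  have ht := h.t_ne_zero
  have h1' : q - 1 ≠ 0 := sub_ne_zero.2 h.q_ne_one
  have h2' : t - 1 ≠ 0 := sub_ne_zero.2 h.t_ne_one
  rw [hilbertTerm, factor_inv_q, factor_inv_t, omega_inv_q, omega_inv_t, omega_t_div_q]
  field_simp
  ring

/-- The factor (1-q)(1-t) accounts for the two free variables, and the four tableaux match the four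
summands one by one. -/
theorem H_eq (d₁ d₂ d₃ : ℕ) :
    (1 - q) * (1 - t) * H ![d₁, d₂, d₃] = hilbertRat q t d₁ d₂ := by
  rw [H_eq_sum_hilbertTerm, hilbertRat_eq generic_q_t, mul_add, mul_add, mul_add, hilbertTerm_row,
    hilbertTerm_col, hilbertTerm_hook, hilbertTerm_hook']
  ring

theorem generatingTerm_row (m n : ℕ) : generatingTerm m n q (q ^ 2) =
    q ^ (2 * m + n) * q ^ 3 / ((q - t) * (q ^ 2 - t)) := by
  have h := generic_q_t
  obtain ⟨h1, h2, h3, h4, h5, h6, h7, h8⟩ := h.one_sub_ne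
  have hq := h.q_ne_zero
  have h1' : q - 1 ≠ 0 := sub_ne_zero.2 h.q_ne_one
  have h9 : q ^ 2 - 1 ≠ 0 := sub_ne_zero.2 h.q_sq_ne_one
  have e : q / q ^ 2 = q⁻¹ := by field_simp
  have e1 : q * t / q = t := by field_simp
  have e2 : q * t * q / q ^ 2 = t := by field_simp
  rw [generatingTerm, e1, e2, factor_of_ne h.t_ne_one, factor_inv_q, factor_inv_q_sq, omega_inv_q,
    omega_inv_q_sq, e, omega_inv_q, pow_add q, pow_mul q 2 m]
  field_simp
  ring

theorem generatingTerm_col (m n : ℕ) : generatingTerm m n t (t ^ 2) =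
    - (t ^ (2 * m + n) * t ^ 3 / ((q - t) * (t ^ 2 - q))) := by
  have h := generic_q_t
  obtain ⟨h1, h2, h3, h4, h5, h6, h7, h8⟩ := h.one_sub_ne
  have ht := h.t_ne_zero
  have h1' : t - 1 ≠ 0 := sub_ne_zero.2 h.t_ne_one
  have h9 : t ^ 2 - 1 ≠ 0 := sub_ne_zero.2 h.t_sq_ne_one
  have e : t / t ^ 2 = t⁻¹ := by field_simp
  have e1 : q * t / t = q := by field_simp
  have e2 : q * t * t / t ^ 2 = q := by field_simp
  rw [generatingTerm, e1, e2, factor_of_ne h.q_ne_one, factor_inv_t, factor_inv_t_sq, omega_inv_t,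
    omega_inv_t_sq, e, omega_inv_t, pow_add t, pow_mul t 2 m]
  field_simp
  ring

theorem generatingTerm_hook (m n : ℕ) : generatingTerm m n q t =
    - (q ^ n * t ^ m * (q * t) / ((q - t) * (q ^ 2 - t))) := by
  have h := generic_q_t
  obtain ⟨h1, h2, h3, h4, h5, h6, h7, h8⟩ := h.one_sub_ne
  have hq := h.q_ne_zero
  have ht := h.t_ne_zero
  have h1' : q - 1 ≠ 0 := sub_ne_zero.2 h.q_ne_one
  have h2' : t - 1 ≠ 0 := sub_ne_zero.2 h.t_ne_one
  have h9 : 1 - q ^ 2 ≠ 0 := sub_ne_zero.2 h.q_sq_ne_one.symm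
  have e1 : q * t / q = t := by field_simp
  have e2 : q * t * q / t = q ^ 2 := by field_simp
  rw [generatingTerm, e1, e2, factor_of_ne h.t_ne_one, factor_of_ne h.q_sq_ne_one, factor_inv_q,
    factor_inv_t, omega_inv_q, omega_inv_t, omega_q_div_t]
  field_simp
  ring

theorem generatingTerm_hook' (m n : ℕ) : generatingTerm m n t q =
    q ^ m * t ^ n * (q * t) / ((q - t) * (t ^ 2 - q)) := by
  have h := generic_q_t
  obtain ⟨h1, h2, h3, h4, h5, h6, h7, h8⟩ := h.one_sub_ne
  have hq := h.q_ne_zero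
  have ht := h.t_ne_zero
  have h1' : q - 1 ≠ 0 := sub_ne_zero.2 h.q_ne_one
  have h2' : t - 1 ≠ 0 := sub_ne_zero.2 h.t_ne_one
  have h9 : 1 - t ^ 2 ≠ 0 := sub_ne_zero.2 h.t_sq_ne_one.symm
  have e1 : q * t / t = q := by field_simp
  have e2 : q * t * t / q = t ^ 2 := by field_simp
  rw [generatingTerm, e1, e2, factor_of_ne h.q_ne_one, factor_of_ne h.t_sq_ne_one, factor_inv_q,
    factor_inv_t, omega_inv_q, omega_inv_t, omega_t_div_q]
  field_simp
  ring

theorem F_eq (d₁ d₂ d₃ : ℕ) : F ![d₁, d₂, d₃] = generatingRat q t d₁ d₂ := by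
  rw [F_eq_sum_generatingTerm, generatingRat_eq generic_q_t, generatingTerm_row,
    generatingTerm_col, generatingTerm_hook, generatingTerm_hook']
  ring

/-! ### Passage to the fraction field of the power series ring -/

theorem map_hilbertRat {K L : Type*} [Field K] [Field L] (f : K →+* L) (x y : K) (m n : ℕ) :
    f (hilbertRat x y m n) = hilbertRat (f x) (f y) m n := by
  simp [hilbertRat]

theorem map_generatingRat {K L : Type*} [Field K] [Field L] (f : K →+* L) (x y : K) (m n : ℕ) :
    f (generatingRat x y m n) = generatingRat (f x) (f y) m n := by
  simp [generatingRat]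

theorem ratToFrac_algebraMap (f : MvPolynomial (Fin 2) ℚ) :
    ratToFrac (algebraMap (MvPolynomial (Fin 2) ℚ) RatQT f) =
      algebraMap SeriesQT (FractionRing SeriesQT) f :=
  IsLocalization.map_eq (nonZeroDivisors_le_comap_nonZeroDivisors_of_injective
    (MvPolynomial.coeToMvPowerSeries.ringHom : MvPolynomial (Fin 2) ℚ →+* SeriesQT)
    (MvPolynomial.coe_injective (Fin 2) ℚ)) f

theorem ratToFrac_q :
    ratToFrac q = algebraMap SeriesQT (FractionRing SeriesQT) (MvPowerSeries.X 0) := by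
  rw [q, ratToFrac_algebraMap, MvPolynomial.coe_X]

theorem ratToFrac_t :
    ratToFrac t = algebraMap SeriesQT (FractionRing SeriesQT) (MvPowerSeries.X 1) := by
  rw [t, ratToFrac_algebraMap, MvPolynomial.coe_X]

theorem generic_series : Generic
    (algebraMap SeriesQT (FractionRing SeriesQT) (MvPowerSeries.X 0))
    (algebraMap SeriesQT (FractionRing SeriesQT) (MvPowerSeries.X 1)) := by
  rw [← ratToFrac_q, ← ratToFrac_t]
  exact generic_q_t.map ratToFrac

theorem seriesEqRat_partSeries_J {m n : ℕ} (hmn : m ≤ n) :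
    SeriesEqRat (partSeries weightABCD (J m n)) (hilbertRat q t m n) := by
  rw [SeriesEqRat, map_partSeries_J generic_series hmn, map_hilbertRat, ratToFrac_q, ratToFrac_t]

theorem seriesEqRat_generatorSeries {m n : ℕ} (hmn : m ≤ n) :
    SeriesEqRat (generatorSeries m n) (generatingRat q t m n) := by
  rw [SeriesEqRat, map_generatorSeries generic_series hmn, map_generatingRat, ratToFrac_q,
    ratToFrac_t]

theorem SeriesEqRat.of_mul {f g : SeriesQT} {x y : RatQT} (hg : SeriesEqRat g y) (hy : y ≠ 0)
    (h : SeriesEqRat (g * f) (y * x)) : SeriesEqRat f x := by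
  rw [SeriesEqRat] at *
  rw [map_mul, map_mul, hg] at h
  exact mul_left_cancel₀ ((map_ne_zero ratToFrac).2 hy) h

theorem seriesEqRat_one_sub_mul_one_sub :
    SeriesEqRat ((1 - MvPowerSeries.X 0) * (1 - MvPowerSeries.X 1)) ((1 - q) * (1 - t)) := by
  rw [SeriesEqRat]
  simp only [map_mul, map_sub, map_one, ratToFrac_q, ratToFrac_t]

end

end GenHaiman

theorem theorem4p8 (d₁ d₂ d₃ : ℕ) (h₁₂ : d₁ ≤ d₂) (h₂₃ : d₂ ≤ d₃) :
    GenHaiman.SeriesEqRat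
      (GenHaiman.hilbertSeries
        (GenHaiman.idealPiece (GenHaiman.weightTX 3) (GenHaiman.JPrime ![d₁, d₂, d₃])))
      (GenHaiman.H ![d₁, d₂, d₃]) ∧
    GenHaiman.SeriesEqRat
      (GenHaiman.hilbertSeries
        (GenHaiman.generatingPiece (GenHaiman.weightTX 3) (GenHaiman.JPrime ![d₁, d₂, d₃])))
      (GenHaiman.F ![d₁, d₂, d₃]) ∧
    GenHaiman.SeriesEqRat
      (GenHaiman.hilbertSeries
        (GenHaiman.idealPiece GenHaiman.weightABCD (GenHaiman.J d₁ d₂)))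
      (open GenHaiman in
        q ^ (2 * d₁ + d₂) / ((1 - q) ^ 2 * (1 - t / q) * (1 - t / q ^ 2)) +
        t ^ (2 * d₁ + d₂) / ((1 - t) ^ 2 * (1 - q / t) * (1 - q / t ^ 2)) +
        q ^ d₁ * t ^ d₂ * (1 + t) / ((1 - q) * (1 - t) * (1 - q / t) * (1 - t ^ 2 / q)) +
        q ^ d₂ * t ^ d₁ * (1 + q) / ((1 - t) * (1 - q) * (1 - t / q) * (1 - q ^ 2 / t))) := by
  open GenHaiman in
  have hne := generic_q_t.one_sub_ne
  refine ⟨?_, ?_, ?_⟩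
  · rw [hilbertSeries_idealPiece]
    refine SeriesEqRat.of_mul seriesEqRat_one_sub_mul_one_sub (mul_ne_zero hne.1 hne.2.1) ?_
    rw [partSeries_JPrime h₁₂ h₂₃, H_eq]
    exact seriesEqRat_partSeries_J h₁₂
  · rw [hilbertSeries_generatingPiece_JPrime h₁₂ h₂₃, F_eq]
    exact seriesEqRat_generatorSeries h₁₂
  · rw [hilbertSeries_idealPiece]
    exact seriesEqRat_partSeries_J h₁₂
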